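/- Let $H$ be a complex Hilbert space and write $(\cdot|\cdot)$ for its inner product. Let $A$ be a closed, densely defined linear operator in $H$, let $B$, $C$ be densely defined, symmetric, nonnegative linear operators in $H$, and let $$T=\begin{pmatrix}A&B\\ C&-A^*\end{pmatrix}\quad\text{in } H\times H,\qquad \mathcal D(T)=(\mathcal D(A)\cap\mathcal D(C))\times(\mathcal D(B)\cap\mathcal D(A^*)).$$ We use the following terminology. - For $p\in[0,1]$, an operator $R$ is *$p$-subordinate* to $S$ if $\mathcal D(S)\subset\mathcal D(R)$ and $\|Rx\|\le c\,\|x\|^{1-p}\|Sx\|^{p}$ for some $c\ge 0$ and all $x\in\mathcal D(S)$. - A densely defined operator $S$ on a Banach space $V$ is *dichotomous* with spectral subspaces $V_+,V_-$ if $V=V_+\oplus V_-$ with closed subspaces $V_\pm$ that are $S$-invariant (i.e. $S(\mathcal D(S)\cap V_\pm)\subset V_\pm$), $\{z:|\operatorname{Re}z|<h\}\subset\varrho(S)$ for some $h>0$, and $\sigma(S|_{V_+})\subset\{\operatorname{Re}z>0\}$, $\sigma(S|_{V_-})\subset\{\operatorname{Re}z<0\}$. - A densely defined operator $S$ is *sectorial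 with angle* $\theta\in[0,\pi)$ if $\sigma(S)\subset\{z:|\arg z|\le\theta\}$ and for every $\theta'\in(\theta,\pi]$ there is $M>0$ with $\|(S-z)^{-1}\|\le M/|z|$ for all $z\ne0$ with $|\arg z|\ge\theta'$ (where $-\pi<\arg z\le\pi$ and $\arg 0=0$). - $S$ is *sectorially dichotomous* if, for some $\theta\in[0,\pi/2)$, it is dichotomous with spectral subspaces $V_\pm$ such that $S|_{V_+}$ and $-S|_{V_-}$ are sectorial with angle $\theta$. Assume that, for some $p\in[0,1)$, $C$ is $p$-subordinate to $A$ and $B$ is $p$-subordinate to $-A^*$, that $A$ is sectorially dichotomous, and that $$\bigcap_{t\in\mathbb R}\ker\bigl(B(A^*+\mathrm i t)^{-1}\bigr)=\{0\}.$$ Then there exist linear operators $X_+$, $X_-$ in $H$ such that: 1. $T$ is dichotomous with spectral subspaces the graphs $V_\pm=G(X_\pm)=\{(u,X_\pm u): u\in\mathcal D(X_\pm)\}$; here $V_\pm$ are the spectral subspaces whose projections $P_\pm$ (associated with $H\times H=V_+\oplus V_-$) are given by the Cauchy principal value at infinity $$P_+x-P_-x=\frac1{\pi\mathrm i}\int_{\mathrm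 i\mathbb R}'(T-z)^{-1}x\,dz,\qquad x\in H\times H;$$ 2. $X_+$ and $X_-$ are selfadjoint, $X_+$ is nonnegative and $X_-$ is nonpositive; 3. $\mathcal D(A)\cap X_\pm^{-1}\mathcal D(A^*)=\{u\in\mathcal D(A)\cap\mathcal D(X_\pm): X_\pm u\in\mathcal D(A^*)\}$ is a core for $X_\pm$, and for every $u$ in this set $(A+BX_\pm)u\in\mathcal D(X_\pm)$ and $$\bigl(A^*X_\pm+X_\pm(A+BX_\pm)-C\bigr)u=0.$$ -/

import Mathlib

open scoped LinearPMap

namespace Dichotomy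

section Banach

variable {E : Type*} [NormedAddCommGroup E] [NormedSpace ℂ E]

/-- `R` is the bounded everywhere defined inverse of `S - z`. -/
structure IsResolventAt (S : E →ₗ.[ℂ] E) (z : ℂ) (R : E →L[ℂ] E) : Prop where
  mem_domain : ∀ x : E, R x ∈ S.domain
  right_inv : ∀ x : E, S ⟨R x, mem_domain x⟩ - z • R x = x
  left_inv : ∀ x : S.domain, R (S x - z • (x : E)) = x

theorem IsResolventAt.unique {S : E →ₗ.[ℂ] E} {z : ℂ} {R R' : E →L[ℂ] E}
    (h : IsResolventAt S z R) (h' : IsResolventAt S z R') : R = R' := by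
  ext x
  have h1 := h'.left_inv ⟨R x, h.mem_domain x⟩
  rw [h.right_inv x] at h1
  exact h1.symm

/-- The resolvent set of a linear operator. -/
def opResolventSet (S : E →ₗ.[ℂ] E) : Set ℂ :=
  {z | ∃ R : E →L[ℂ] E, IsResolventAt S z R}

/-- The spectrum of a linear operator. -/
def opSpectrum (S : E →ₗ.[ℂ] E) : Set ℂ := (opResolventSet S)ᶜ

open scoped Classical in
/-- The resolvent `(S - z)⁻¹` (with value `0` if `z` is not in the resolvent set). -/
noncomputable def opResolvent (S : E →ₗ.[ℂ] E) (z : ℂ) : E →L[ℂ] E :=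
  if h : z ∈ opResolventSet S then h.choose else 0

theorem isResolventAt_opResolvent {S : E →ₗ.[ℂ] E} {z : ℂ} (h : z ∈ opResolventSet S) :
    IsResolventAt S z (opResolvent S z) := by
  rw [opResolvent, dif_pos h]
  exact h.choose_spec

/-- The subspace `V` is `S`-invariant: `S (D(S) ∩ V) ⊆ V`. -/
def IsInvariant (S : E →ₗ.[ℂ] E) (V : Submodule ℂ E) : Prop :=
  ∀ x : S.domain, (x : E) ∈ V → S x ∈ V

/-- The restriction of `S` to `V`, as an operator on the normed space `V`, with domain
`{x ∈ D(S) ∩ V | S x ∈ V}`; this is `D(S) ∩ V` if `V` is `S`-invariant. -/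
noncomputable def restrict (S : E →ₗ.[ℂ] E) (V : Submodule ℂ E) : V →ₗ.[ℂ] V :=
  (S.graph.comap (V.subtype.prodMap V.subtype)).toLinearPMap

theorem mem_graph_restrict (S : E →ₗ.[ℂ] E) (V : Submodule ℂ E) (x y : V) :
    (x, y) ∈ (restrict S V).graph ↔ ((x : E), (y : E)) ∈ S.graph := by
  rw [restrict, Submodule.toLinearPMap_graph_eq]
  · simp
  · rintro ⟨a, b⟩ hx hx'
    have h : ((a : E), (b : E)) ∈ S.graph := by simpa using hx
    have ha : (a : E) = 0 := by simpa using hx'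
    exact Subtype.ext (S.graph_fst_eq_zero_snd h ha)

/-- `S` is dichotomous with spectral subspaces `Vp`, `Vm` (for the right and the left half-plane,
respectively). -/
structure IsDichotomousWith (S : E →ₗ.[ℂ] E) (Vp Vm : Submodule ℂ E) : Prop where
  dense_domain : Dense (S.domain : Set E)
  isClosed_pos : IsClosed (Vp : Set E)
  isClosed_neg : IsClosed (Vm : Set E)
  isCompl : IsCompl Vp Vm
  gap : ∃ h : ℝ, 0 < h ∧ {z : ℂ | |z.re| < h} ⊆ opResolventSet S
  invariant_pos : IsInvariant S Vp
  invariant_neg : IsInvariant S Vm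
  spectrum_pos : opSpectrum (restrict S Vp) ⊆ {z : ℂ | 0 < z.re}
  spectrum_neg : opSpectrum (restrict S Vm) ⊆ {z : ℂ | z.re < 0}

/-- The sector `Σ_θ`; note `Complex.arg 0 = 0`. -/
def sector (θ : ℝ) : Set ℂ := {z | |z.arg| ≤ θ}

/-- `S` is sectorial with angle `θ` (and radius `0`). -/
structure IsSectorial (S : E →ₗ.[ℂ] E) (θ : ℝ) : Prop where
  angle_nonneg : 0 ≤ θ
  angle_lt : θ < Real.pi
  dense_domain : Dense (S.domain : Set E)
  spectrum_subset : opSpectrum S ⊆ sector θ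
  resolvent_bound : ∀ θ' : ℝ, θ < θ' → θ' ≤ Real.pi → ∃ M : ℝ, 0 < M ∧
    ∀ z : ℂ, z ≠ 0 → θ' ≤ |z.arg| → ‖opResolvent S z‖ ≤ M / ‖z‖

/-- `S` is sectorially dichotomous with angle `θ ∈ [0, π/2)`. -/
def IsSectoriallyDichotomousWith (S : E →ₗ.[ℂ] E) (θ : ℝ) : Prop :=
  0 ≤ θ ∧ θ < Real.pi / 2 ∧ ∃ Vp Vm : Submodule ℂ E, IsDichotomousWith S Vp Vm ∧
    IsSectorial (restrict S Vp) θ ∧ IsSectorial (-(restrict S Vm)) θ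

/-- `S` is sectorially dichotomous (with some angle). -/
def IsSectoriallyDichotomous (S : E →ₗ.[ℂ] E) : Prop :=
  ∃ θ : ℝ, IsSectoriallyDichotomousWith S θ

/-- The projections `P₊`, `P₋` belonging to `E = Vp ⊕ Vm` are given by the Cauchy principal value
`(1 / (π i)) ∫'_{iℝ} (S - z)⁻¹ w dz = P₊ w - P₋ w` for all `w = x + y`, `x ∈ Vp`, `y ∈ Vm`. -/
def HasResolventIntegralProjections (S : E →ₗ.[ℂ] E) (Vp Vm : Submodule ℂ E) : Prop :=
  ∀ x ∈ Vp, ∀ y ∈ Vm, Filter.Tendsto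
    (fun N : ℝ => (1 / ((Real.pi : ℂ) * Complex.I)) •
      ∫ t in (-N)..N, Complex.I • opResolvent S ((t : ℂ) * Complex.I) (x + y))
    Filter.atTop (nhds (x - y))

end Banach

/-- `R` is `p`-subordinate to `S`. -/
def IsSubordinate {E F G : Type*} [NormedAddCommGroup E] [NormedSpace ℂ E]
    [NormedAddCommGroup F] [NormedSpace ℂ F] [NormedAddCommGroup G] [NormedSpace ℂ G]
    (p : ℝ) (R : E →ₗ.[ℂ] F) (S : E →ₗ.[ℂ] G) : Prop :=
  ∃ hdom : S.domain ≤ R.domain, ∃ c : ℝ, 0 ≤ c ∧ ∀ x : S.domain,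
    ‖R ⟨x, hdom x.2⟩‖ ≤ c * ‖(x : E)‖ ^ (1 - p) * ‖S x‖ ^ p

section Hilbert

variable {H : Type*} [NormedAddCommGroup H] [InnerProductSpace ℂ H]

/-- The block operator matrix `[[A, B], [C, D]]` in `H × H`, with domain
`(D(A) ∩ D(C)) × (D(B) ∩ D(D))`. -/
def blockOperator (A B C D : H →ₗ.[ℂ] H) : (H × H) →ₗ.[ℂ] (H × H) where
  domain := (A.domain ⊓ C.domain).prod (B.domain ⊓ D.domain)
  toFun :=
    { toFun := fun x =>
        (A ⟨x.1.1, x.2.1.1⟩ + B ⟨x.1.2, x.2.2.1⟩, C ⟨x.1.1, x.2.1.2⟩ + D ⟨x.1.2, x.2.2.2⟩)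
      map_add' := fun x y => by
        have hA := A.map_add ⟨x.1.1, x.2.1.1⟩ ⟨y.1.1, y.2.1.1⟩
        have hB := B.map_add ⟨x.1.2, x.2.2.1⟩ ⟨y.1.2, y.2.2.1⟩
        have hC := C.map_add ⟨x.1.1, x.2.1.2⟩ ⟨y.1.1, y.2.1.2⟩
        have hD := D.map_add ⟨x.1.2, x.2.2.2⟩ ⟨y.1.2, y.2.2.2⟩
        refine Prod.ext ?_ ?_
        · exact (congrArg₂ (· + ·) hA hB).trans (add_add_add_comm _ _ _ _)
        · exact (congrArg₂ (· + ·) hC hD).trans (add_add_add_comm _ _ _ _)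
      map_smul' := fun a x => by
        have hA := A.map_smul a ⟨x.1.1, x.2.1.1⟩
        have hB := B.map_smul a ⟨x.1.2, x.2.2.1⟩
        have hC := C.map_smul a ⟨x.1.1, x.2.1.2⟩
        have hD := D.map_smul a ⟨x.1.2, x.2.2.2⟩
        refine Prod.ext ?_ ?_
        · exact (congrArg₂ (· + ·) hA hB).trans (smul_add _ _ _).symm
        · exact (congrArg₂ (· + ·) hC hD).trans (smul_add _ _ _).symm }

/-- `B` is symmetric: densely defined with `(B x | y) = (x | B y)` on its domain. -/
def IsSymmetricOp (B : H →ₗ.[ℂ] H) : Prop :=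
  Dense (B.domain : Set H) ∧ B.IsFormalAdjoint B

/-- `(B x | x) ≥ 0` on the domain of `B` (for symmetric `B`). -/
def IsNonnegativeOp (B : H →ₗ.[ℂ] H) : Prop :=
  ∀ x : B.domain, 0 ≤ (inner ℂ (x : H) (B x)).re

/-- `(B x | x) ≤ 0` on the domain of `B` (for symmetric `B`). -/
def IsNonpositiveOp (B : H →ₗ.[ℂ] H) : Prop :=
  ∀ x : B.domain, (inner ℂ (x : H) (B x)).re ≤ 0

variable [CompleteSpace H]

/-- The operator matrix `T = [[A, B], [C, -A*]]` in `H × H`. -/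
noncomputable def hamiltonian (A B C : H →ₗ.[ℂ] H) : (H × H) →ₗ.[ℂ] (H × H) :=
  blockOperator A B C (-A†)

/-- The entries `A`, `B`, `C` define a nonnegative Hamiltonian `[[A, B], [C, -A*]]`. -/
structure IsNonnegativeHamiltonian (A B C : H →ₗ.[ℂ] H) : Prop where
  dense_A : Dense (A.domain : Set H)
  closed_A : A.IsClosed
  symm_B : IsSymmetricOp B
  symm_C : IsSymmetricOp C
  nonneg_B : IsNonnegativeOp B
  nonneg_C : IsNonnegativeOp C

/-- The Hamiltonian `[[A, B], [C, -A*]]` is diagonally `p`-dominant. -/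
def IsDiagonallyDominant (p : ℝ) (A B C : H →ₗ.[ℂ] H) : Prop :=
  IsSubordinate p C A ∧ IsSubordinate p B (-A†)

/-- The kernel of `B (A* + i t)⁻¹`: all `w` with `(A* + i t)⁻¹ w ∈ D(B)` and
`B (A* + i t)⁻¹ w = 0`. -/
noncomputable def kerBResolvent (A B : H →ₗ.[ℂ] H) (t : ℝ) : Set H :=
  {w | ∃ h : opResolvent (A†) (-((t : ℂ) * Complex.I)) w ∈ B.domain,
    B ⟨opResolvent (A†) (-((t : ℂ) * Complex.I)) w, h⟩ = 0}

/-- The subspace `D(A) ∩ X⁻¹ D(A*)`. -/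
noncomputable def riccatiDomain (A X : H →ₗ.[ℂ] H) : Submodule ℂ H :=
  A.domain ⊓ (A†.domain.comap X.toFun).map X.domain.subtype

theorem mem_riccatiDomain (A X : H →ₗ.[ℂ] H) (u : H) :
    u ∈ riccatiDomain A X ↔
      u ∈ A.domain ∧ ∃ h : u ∈ X.domain, X ⟨u, h⟩ ∈ A†.domain := by
  simp [riccatiDomain]

/-- `(A* X + X (A + B X) - C) u = 0` for all `u ∈ D(A) ∩ X⁻¹ D(A*)`, including the assertion that
every term is defined. -/
def SolvesRiccati (A B C X : H →ₗ.[ℂ] H) : Prop :=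
  ∀ u ∈ riccatiDomain A X,
    ∃ (hA : u ∈ A.domain) (hC : u ∈ C.domain) (hX : u ∈ X.domain)
      (hA' : X ⟨u, hX⟩ ∈ A†.domain) (hB : X ⟨u, hX⟩ ∈ B.domain)
      (hv : A ⟨u, hA⟩ + B ⟨X ⟨u, hX⟩, hB⟩ ∈ X.domain),
      A† ⟨X ⟨u, hX⟩, hA'⟩ + X ⟨A ⟨u, hA⟩ + B ⟨X ⟨u, hX⟩, hB⟩, hv⟩ - C ⟨u, hC⟩ = 0

end Hilbert

end Dichotomy

/-! Everything rests on the sign operator `U` of the Hamiltonian `T`: the strong principal value of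
`π⁻¹ ∫ (T - it)⁻¹ dt`. Its eigenspaces for `1` and `-1` are the spectral subspaces.

For any operator `S` whose resolvents on the imaginary axis are `O(1 / (1 + |t|))` and have bounded
symmetric integrals (`HasImaginaryResolvent`), `U` exists and `U S⁻¹ = (2/π) ∫₀^∞ (S² + t²)⁻¹ dt`.
The right side squares to `S⁻²` by a Fubini and Frullani computation (`integral_mul_integral_eq`),
so `U² = 1` (`sign_mul_self`). The eigenspaces reduce `S`, and integrating `(it - z)⁻¹ (S - it)⁻¹`
inverts `S - z` on each of them in the opposite half-plane (`halfPlaneResolvent_sub`).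

`A` has this property by Cauchy's theorem on its two sectorial parts, and `-A*` by taking adjoints.
For `T`, the real part of the form `(u, v) ↦ (f | v) + (g | u)` with `(f, g) = (T - it)(u, v)` is
`(Bv | v) + (Cu | u)`. With Cauchy-Schwarz for the forms of `B` and `C` this gives a lower bound for
`T - it` of order `1 + |t|` (`norm_le_of_mem_graph_hamiltonian`), hence surjectivity by continuation
from large `t`. Subordination makes the difference from the diagonal resolvent `O(|t|^(p-2))`, which
is integrable (`hasImaginaryResolvent_hamiltonian`).

Two indefinite forms then describe the subspaces. `T` is skew for the symplectic form, so each
subspace equals its own symplectic complement; a graph with this property belongs to a selfadjoint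
operator. The energy form is nonnegative along the resolvents, which gives the signs of `X₊` and
`X₋`; its degenerate case, with the kernel condition, excludes vectors `(0, w)` and so makes the
subspaces graphs (`eq_zero_of_mem_signSpace`). The Riccati equation is invariance of the graph under
`T`. -/

namespace Dichotomy

/-! ### The square root integral for a resolvent family. -/

section SquareRoot

open MeasureTheory Set Filter Topology

variable {𝔸 : Type*} [NormedRing 𝔸] [NormedAlgebra ℝ 𝔸]

theorem integrable_of_norm_le_div_one_add_sq {F : Type*} [NormedAddCommGroup F] {f : ℝ → F}
    {M : ℝ} (hf : Continuous f) (hM : ∀ t, ‖f t‖ ≤ M / (1 + t ^ 2)) : Integrable f := by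
  refine (integrable_inv_one_add_sq.const_mul M).mono' hf.aestronglyMeasurable ?_
  exact ae_of_all _ fun t => by simpa [div_eq_mul_inv] using hM t

/-- The weight `t` cancels the Jacobian of `s ↦ t * s`, so the norm integral over a slice is at most
`‖f t‖ * ∫ ‖f‖`. -/
theorem integrable_mul_comp_mul {f : ℝ → 𝔸} {M : ℝ} (hf : Continuous f)
    (hM : ∀ t, ‖f t‖ ≤ M / (1 + t ^ 2)) :
    Integrable (Function.uncurry fun t s : ℝ => t • (f t * f (t * s)))
      ((volume.restrict (Ioi 0)).prod (volume.restrict (Ioi 0))) := by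
  have hcont : Continuous (Function.uncurry fun t s : ℝ => t • (f t * f (t * s))) := by
    simp only [Function.uncurry_def]; fun_prop
  have hint := integrable_of_norm_le_div_one_add_sq hf hM
  have hslice : ∀ t ∈ Ioi (0 : ℝ), IntegrableOn (fun s => t • (f t * f (t * s))) (Ioi 0) := by
    intro t ht
    refine (((hint.comp_mul_left' (ne_of_gt ht)).const_mul (f t)).smul t).integrableOn
  rw [integrable_prod_iff hcont.aestronglyMeasurable]
  refine ⟨(ae_restrict_iff' measurableSet_Ioi).2 (ae_of_all _ hslice), ?_⟩
  have hmeas : AEStronglyMeasurable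
      (fun t : ℝ => ∫ s in Ioi (0 : ℝ), ‖Function.uncurry (fun t s : ℝ => t • (f t * f (t * s))) (t, s)‖)
      (volume.restrict (Ioi 0)) :=
    hcont.norm.aestronglyMeasurable.integral_prod_right'
  refine ((hint.norm.mul_const (∫ s in Ioi (0 : ℝ), ‖f s‖)).integrableOn).mono' hmeas ?_
  refine (ae_restrict_iff' measurableSet_Ioi).2 (ae_of_all _ fun t ht => ?_)
  have ht' : 0 < t := ht
  rw [Real.norm_of_nonneg (integral_nonneg fun _ => norm_nonneg _)]
  have h1 : ∫ s in Ioi (0 : ℝ), ‖f (t * s)‖ = t⁻¹ * ∫ s in Ioi (0 : ℝ), ‖f s‖ := by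
    simpa using integral_comp_mul_left_Ioi (fun s => ‖f s‖) 0 ht'
  calc ∫ s in Ioi (0 : ℝ), ‖t • (f t * f (t * s))‖
      ≤ ∫ s in Ioi (0 : ℝ), t * ‖f t‖ * ‖f (t * s)‖ := by
        refine setIntegral_mono_on (hslice t ht).norm
          ((hint.comp_mul_left' ht'.ne').norm.const_mul _).integrableOn measurableSet_Ioi ?_
        intro s _
        rw [norm_smul, Real.norm_of_nonneg ht'.le, mul_assoc]
        gcongr
        exact norm_mul_le _ _
    _ = ‖f t‖ * ∫ s in Ioi (0 : ℝ), ‖f s‖ := by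
        rw [integral_const_mul, h1]; field_simp

/-- Substituting `t * s` in the second factor and exchanging the integrals leaves an inner integral
of Frullani type. -/
theorem sq_integral_eq_integral_mul_comp_mul {f : ℝ → 𝔸} {M : ℝ} (hf : Continuous f)
    (hM : ∀ t, ‖f t‖ ≤ M / (1 + t ^ 2)) :
    (∫ t in Ioi (0 : ℝ), f t) * (∫ t in Ioi (0 : ℝ), f t) =
      ∫ s in Ioi (0 : ℝ), ∫ t in Ioi (0 : ℝ), t • (f t * f (t * s)) := by
  have hint := integrable_of_norm_le_div_one_add_sq hf hM
  rw [← integral_integral_swap (integrable_mul_comp_mul hf hM)]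
  rw [← integral_mul_const_of_integrable hint.integrableOn]
  refine setIntegral_congr_fun measurableSet_Ioi fun t ht => ?_
  have ht' : 0 < t := ht
  have h1 : ∫ s in Ioi (0 : ℝ), f (t * s) = t⁻¹ • ∫ s in Ioi (0 : ℝ), f s := by
    simpa using integral_comp_mul_left_Ioi f 0 ht'
  have h2 : ∫ s in Ioi (0 : ℝ), f t * f (t * s) = f t * ∫ s in Ioi (0 : ℝ), f (t * s) :=
    integral_const_mul_of_integrable (hint.comp_mul_left' ht'.ne').integrableOn
  simp only [integral_smul, h2, h1]
  rw [mul_smul_comm, smul_smul, mul_inv_cancel₀ ht'.ne', one_smul]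

variable [CompleteSpace 𝔸]

/-- The resolvent identity at `t` and `t * s` rewrites the integrand as `(s² - 1)⁻¹ t⁻¹ (f t - f (s
t))`, a Frullani integrand. Since `f` vanishes at infinity, only `f 0` and a logarithm survive. -/
theorem integral_smul_mul_comp_mul {f : ℝ → 𝔸} {M : ℝ} (hf : Continuous f)
    (hM : ∀ t, ‖f t‖ ≤ M / (1 + t ^ 2))
    (hres : ∀ t s : ℝ, f t - f s = (s ^ 2 - t ^ 2) • (f t * f s)) {s : ℝ} (hs : 0 < s)
    (hs1 : s ≠ 1) :
    ∫ t in Ioi (0 : ℝ), t • (f t * f (t * s)) = (Real.log s / (s ^ 2 - 1)) • f 0 := by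
  have hint := integrable_of_norm_le_div_one_add_sq hf hM
  have hs2 : s ^ 2 - 1 ≠ 0 := by
    intro h
    have : (s - 1) * (s + 1) = 0 := by linarith
    rcases mul_eq_zero.1 this with h | h
    · exact hs1 (by linarith)
    · linarith
  have hM0 : 0 ≤ M := by simpa using (norm_nonneg _).trans (hM 0)
  have key : ∀ t ∈ Ioi (0 : ℝ), t • (f t * f (t * s)) =
      (s ^ 2 - 1)⁻¹ • (t⁻¹ • (f (1 * t) - f (s * t))) := by
    intro t ht
    have ht' : t ≠ 0 := ne_of_gt ht
    rw [one_mul, mul_comm s t, hres t (t * s), smul_smul, smul_smul]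
    congr 1
    field_simp
  have hg : Integrable (fun t => t • (f t * f (t * s))) := by
    refine ((integrable_of_norm_le_div_one_add_sq hf hM).norm.const_mul (|s|⁻¹ * M)).mono'
      (by fun_prop) (ae_of_all _ fun t => ?_)
    have h1 := hM (t * s)
    have h3 : |t| * (M / (1 + (t * s) ^ 2)) ≤ |s|⁻¹ * M := by
      have hsp : 0 < |s| := abs_pos.2 hs.ne'
      rw [← mul_div_assoc, div_le_iff₀ (by positivity), ← sq_abs (t * s), abs_mul]
      field_simp
      nlinarith [mul_nonneg hM0 (sq_nonneg (|t| * |s| - 1)), mul_nonneg hM0 (sq_nonneg (|t| * |s|))]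
    calc ‖t • (f t * f (t * s))‖ ≤ |t| * (‖f t‖ * ‖f (t * s)‖) := by
          rw [norm_smul, Real.norm_eq_abs]; gcongr; exact norm_mul_le _ _
      _ ≤ |t| * (‖f t‖ * (M / (1 + (t * s) ^ 2))) := by gcongr
      _ = |t| * (M / (1 + (t * s) ^ 2)) * ‖f t‖ := by ring
      _ ≤ |s|⁻¹ * M * ‖f t‖ := by gcongr
  rw [setIntegral_congr_fun measurableSet_Ioi key, integral_smul]
  have hint' : IntegrableOn (fun t => t⁻¹ • (f (1 * t) - f (s * t))) (Ioi 0) := by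
    refine IntegrableOn.congr_fun (hg.integrableOn.smul (s ^ 2 - 1)) ?_ measurableSet_Ioi
    intro t ht
    simp only [Pi.smul_apply]
    rw [key t ht, smul_smul, mul_inv_cancel₀ hs2, one_smul]
  have hzero : Tendsto f atTop (𝓝 0) := by
    refine squeeze_zero_norm' (Eventually.of_forall hM) ?_
    refine Tendsto.div_atTop tendsto_const_nhds ?_
    exact tendsto_atTop_add_const_left _ _ (tendsto_pow_atTop two_ne_zero)
  rw [Frullani.integral_Ioi_eq (hf.locallyIntegrable.locallyIntegrableOn _) one_pos hs
    (hf.tendsto 0 |>.mono_left nhdsWithin_le_nhds) hzero hint', sub_zero, div_one, smul_smul]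
  congr 1
  rw [div_eq_inv_mul]

theorem integral_mul_integral_eq_integral_smul {f : ℝ → 𝔸} {M : ℝ} (hf : Continuous f)
    (hM : ∀ t, ‖f t‖ ≤ M / (1 + t ^ 2))
    (hres : ∀ t s : ℝ, f t - f s = (s ^ 2 - t ^ 2) • (f t * f s)) :
    (∫ t in Ioi (0 : ℝ), f t) * (∫ t in Ioi (0 : ℝ), f t) =
      (∫ s in Ioi (0 : ℝ), Real.log s / (s ^ 2 - 1)) • f 0 := by
  rw [sq_integral_eq_integral_mul_comp_mul hf hM, ← integral_smul_const]
  refine integral_congr_ae ?_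
  have h1 : ∀ᵐ s : ℝ ∂(volume.restrict (Ioi 0)), s ≠ 1 :=
    ae_restrict_of_ae (by simp [ae_iff])
  filter_upwards [h1, ae_restrict_mem measurableSet_Ioi] with s hs1 hs
  exact integral_smul_mul_comp_mul hf hM hres hs hs1

/-- The constant does not depend on the algebra, so it can be read off from the scalar family `1 /
(1 + t²)`, whose integral is `π / 2`. -/
theorem integral_log_div_sq_sub_one :
    ∫ s in Ioi (0 : ℝ), Real.log s / (s ^ 2 - 1) = Real.pi ^ 2 / 4 := by
  have hpos : ∀ t : ℝ, 1 + t ^ 2 ≠ 0 := fun t => by positivity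
  have h := integral_mul_integral_eq_integral_smul (f := fun t : ℝ => (1 + t ^ 2)⁻¹) (M := 1)
    (by fun_prop (disch := exact hpos _)) (fun t => by
      rw [Real.norm_of_nonneg (by positivity), one_div]) (fun t s => by
      have := hpos t
      have := hpos s
      rw [smul_eq_mul]
      field_simp
      ring)
  rw [integral_Ioi_inv_one_add_sq] at h
  simp only [Real.arctan_zero, sub_zero, smul_eq_mul] at h
  norm_num at h
  linarith

/-- The square root formula: `(∫₀^∞ (L + t²)⁻¹ dt)² = (π² / 4) L⁻¹`, for the resolvent family
`f t = (L + t²)⁻¹`. -/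
theorem integral_mul_integral_eq {f : ℝ → 𝔸} {M : ℝ} (hf : Continuous f)
    (hM : ∀ t, ‖f t‖ ≤ M / (1 + t ^ 2))
    (hres : ∀ t s : ℝ, f t - f s = (s ^ 2 - t ^ 2) • (f t * f s)) :
    (∫ t in Ioi (0 : ℝ), f t) * (∫ t in Ioi (0 : ℝ), f t) = (Real.pi ^ 2 / 4) • f 0 := by
  rw [integral_mul_integral_eq_integral_smul hf hM hres, integral_log_div_sq_sub_one]

end SquareRoot

/-! ### Resolvents of unbounded operators in terms of graphs. -/

section Resolvent

variable {E : Type*} [NormedAddCommGroup E] [NormedSpace ℂ E]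

theorem IsResolventAt.mem_graph {S : E →ₗ.[ℂ] E} {z : ℂ} {R : E →L[ℂ] E}
    (h : IsResolventAt S z R) (x : E) : (R x, x + z • R x) ∈ S.graph := by
  rw [LinearPMap.mem_graph_iff]
  exact ⟨⟨R x, h.mem_domain x⟩, rfl, sub_eq_iff_eq_add.1 (h.right_inv x)⟩

theorem IsResolventAt.apply_of_mem_graph {S : E →ₗ.[ℂ] E} {z : ℂ} {R : E →L[ℂ] E}
    (h : IsResolventAt S z R) {x y : E} (hxy : (x, y) ∈ S.graph) : R (y - z • x) = x := by
  obtain ⟨a, rfl, rfl⟩ := (LinearPMap.mem_graph_iff S).1 hxy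
  exact h.left_inv a

theorem isResolventAt_of_graph {S : E →ₗ.[ℂ] E} {z : ℂ} {R : E →L[ℂ] E}
    (h₁ : ∀ x, (R x, x + z • R x) ∈ S.graph)
    (h₂ : ∀ x y, (x, y) ∈ S.graph → R (y - z • x) = x) : IsResolventAt S z R where
  mem_domain x := S.mem_domain_of_mem_graph (h₁ x)
  right_inv x := by
    have := S.mem_graph_snd_inj (h₁ x)
      (S.mem_graph ⟨R x, S.mem_domain_of_mem_graph (h₁ x)⟩) rfl
    rw [← this]
    simp
  left_inv x := h₂ _ _ (S.mem_graph x)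

theorem IsResolventAt.opResolvent_eq {S : E →ₗ.[ℂ] E} {z : ℂ} {R : E →L[ℂ] E}
    (h : IsResolventAt S z R) : opResolvent S z = R :=
  (isResolventAt_opResolvent ⟨R, h⟩).unique h

theorem mem_graph_neg {S : E →ₗ.[ℂ] E} {x y : E} : (x, y) ∈ (-S).graph ↔ (x, -y) ∈ S.graph := by
  simp only [LinearPMap.mem_graph_iff]
  constructor
  · rintro ⟨a, rfl, rfl⟩
    exact ⟨a, rfl, by simp⟩
  · rintro ⟨a, rfl, h⟩
    exact ⟨a, rfl, by simp [h]⟩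

theorem IsResolventAt.neg {S : E →ₗ.[ℂ] E} {z : ℂ} {R : E →L[ℂ] E}
    (h : IsResolventAt S z R) : IsResolventAt (-S) (-z) (-R) := by
  refine isResolventAt_of_graph (fun x => ?_) fun x y hxy => ?_
  · rw [mem_graph_neg]
    have := S.graph.neg_mem (h.mem_graph x)
    simpa [add_comm] using this
  · have := h.apply_of_mem_graph (mem_graph_neg.1 hxy)
    rw [neg_apply, ← map_neg]
    convert this using 2
    simp [add_comm, sub_eq_add_neg]

/-- The resolvent identity. -/
theorem IsResolventAt.sub_eq {S : E →ₗ.[ℂ] E} {z w : ℂ} {R Q : E →L[ℂ] E}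
    (hR : IsResolventAt S z R) (hQ : IsResolventAt S w Q) : R - Q = (z - w) • (R * Q) := by
  ext x
  have h := hR.apply_of_mem_graph (hQ.mem_graph x)
  have h' : x + w • Q x - z • Q x = x - (z - w) • Q x := by rw [sub_smul]; abel
  rw [h', map_sub, map_smul] at h
  simp only [sub_apply, smul_apply,
    mul_apply_eq_comp]
  rw [← sub_eq_iff_eq_add'.2 (sub_eq_iff_eq_add.1 h)]

theorem IsResolventAt.commute {S : E →ₗ.[ℂ] E} {z w : ℂ} {R Q : E →L[ℂ] E}
    (hR : IsResolventAt S z R) (hQ : IsResolventAt S w Q) : Commute R Q := by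
  by_cases hzw : z = w
  · subst hzw
    rw [hR.unique hQ]
  · have h1 := hR.sub_eq hQ
    have h2 := hQ.sub_eq hR
    have h3 : (z - w) • (R * Q) = (z - w) • (Q * R) := by
      rw [← h1, ← neg_sub Q R, h2, ← neg_smul, neg_sub]
    exact smul_right_injective _ (sub_ne_zero.2 hzw) h3

theorem IsResolventAt.injective {S : E →ₗ.[ℂ] E} {z : ℂ} {R : E →L[ℂ] E}
    (h : IsResolventAt S z R) : Function.Injective R := by
  refine (injective_iff_map_eq_zero R).2 fun x hx => ?_
  have := S.graph_fst_eq_zero_snd (h.mem_graph x) hx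
  simpa [hx] using this

theorem IsResolventAt.denseRange {S : E →ₗ.[ℂ] E} {z : ℂ} {R : E →L[ℂ] E}
    (h : IsResolventAt S z R) (hd : Dense (S.domain : Set E)) : DenseRange R := by
  refine hd.mono fun x hx => ?_
  exact ⟨_, h.left_inv ⟨x, hx⟩⟩

/-- Neumann series: the resolvent set is open. -/
theorem IsResolventAt.mem_opResolventSet [CompleteSpace E] {S : E →ₗ.[ℂ] E} {z w : ℂ}
    {R : E →L[ℂ] E} (h : IsResolventAt S w R) (hz : ‖z - w‖ * ‖R‖ < 1) :
    z ∈ opResolventSet S := by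
  have hu : IsUnit (1 - (z - w) • R) := by
    refine (Units.oneSub ((z - w) • R) ?_).isUnit
    rwa [norm_smul]
  obtain ⟨u, hu⟩ := hu
  have hc : Commute (u : E →L[ℂ] E) R := by
    rw [hu]
    exact (Commute.one_left R).sub_left ((Commute.refl R).smul_left _)
  have hc' : ∀ x, R ((u⁻¹ : (E →L[ℂ] E)ˣ).1 x) = (u⁻¹ : (E →L[ℂ] E)ˣ).1 (R x) := fun x =>
    (DFunLike.congr_fun hc.units_inv_left.eq x).symm
  refine ⟨R * (u⁻¹ : (E →L[ℂ] E)ˣ).1, isResolventAt_of_graph (fun x => ?_) fun x y hxy => ?_⟩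
  · set y := (u⁻¹ : (E →L[ℂ] E)ˣ).1 x with hy
    have h1 : u.1 y = x := by
      rw [hy, ← mul_apply_eq_comp, Units.mul_inv, one_apply_eq_self]
    have h2 : y = x + (z - w) • R y := by
      rw [hu] at h1
      simp only [sub_apply, smul_apply,
        one_apply_eq_self] at h1
      rw [← h1]; abel
    have h3 := h.mem_graph y
    have h4 : y + w • R y = x + z • R y := by
      nth_rewrite 1 [h2]
      rw [sub_smul]; abel
    rwa [h4] at h3
  · have h1 := h.apply_of_mem_graph hxy
    have h2 : R (y - z • x) = u.1 x := by
      rw [hu]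
      simp only [sub_apply, smul_apply,
        one_apply_eq_self]
      nth_rewrite 2 [← h1]
      rw [show y - z • x = (y - w • x) - (z - w) • x by rw [sub_smul]; abel, map_sub, map_smul, h1]
    rw [mul_apply_eq_comp, hc', h2, ← mul_apply_eq_comp, Units.inv_mul,
      one_apply_eq_self]

/-- A bounded operator `R` which leaves `V` invariant and inverts `S - z` on `V` gives a resolvent
of the restriction. -/
theorem isResolventAt_restrict {S : E →ₗ.[ℂ] E} {V : Submodule ℂ E} {z : ℂ} (R : E →L[ℂ] E)
    (hV : ∀ x ∈ V, R x ∈ V) (h₁ : ∀ x ∈ V, (R x, x + z • R x) ∈ S.graph)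
    (h₂ : ∀ x ∈ V, ∀ y ∈ V, (x, y) ∈ S.graph → R (y - z • x) = x) :
    IsResolventAt (restrict S V) z ((R.comp V.subtypeL).codRestrict V fun x => hV x x.2) := by
  refine isResolventAt_of_graph (fun x => ?_) fun x y hxy => ?_
  · rw [mem_graph_restrict]
    exact h₁ x x.2
  · rw [mem_graph_restrict] at hxy
    exact Subtype.ext (h₂ x x.2 y y.2 hxy)

end Resolvent

/-! ### Resolvents on the imaginary axis and existence of the sign operator. -/

section ImaginaryResolvent

open MeasureTheory Set Filter Topology

variable {E : Type*} [NormedAddCommGroup E] [NormedSpace ℂ E]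

/-- The imaginary axis belongs to the resolvent set of `S`, with resolvents `r t = (S - i t)⁻¹`
decaying as `1 / |t|` and such that their integrals over `[-N, N]` are uniformly bounded. -/
structure HasImaginaryResolvent (S : E →ₗ.[ℂ] E) (r : ℝ → E →L[ℂ] E) (M K : ℝ) : Prop where
  isResolventAt : ∀ t : ℝ, IsResolventAt S ((t : ℂ) * Complex.I) (r t)
  norm_le : ∀ t : ℝ, ‖r t‖ ≤ M / (1 + |t|)
  norm_integral_le : ∀ N : ℝ, 0 ≤ N → ‖∫ t in (-N)..N, r t‖ ≤ K

theorem imaginary_resolvent_sub {S : E →ₗ.[ℂ] E} {r : ℝ → E →L[ℂ] E}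
    (h : ∀ t : ℝ, IsResolventAt S ((t : ℂ) * Complex.I) (r t)) (s t : ℝ) :
    r s - r t = (((s - t : ℝ) : ℂ) * Complex.I) • (r s * r t) := by
  rw [(h s).sub_eq (h t)]
  push_cast
  rw [sub_mul]

theorem continuous_imaginary_resolvent {S : E →ₗ.[ℂ] E} {r : ℝ → E →L[ℂ] E} {M : ℝ}
    (h : ∀ t : ℝ, IsResolventAt S ((t : ℂ) * Complex.I) (r t)) (hM : ∀ t, ‖r t‖ ≤ M) :
    Continuous r := by
  have hM0 : 0 ≤ M := (norm_nonneg _).trans (hM 0)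
  refine (LipschitzWith.of_dist_le_mul (K := ⟨M * M, mul_nonneg hM0 hM0⟩) fun s t => ?_).continuous
  rw [dist_eq_norm, imaginary_resolvent_sub h, norm_smul, norm_mul, Complex.norm_I, mul_one,
    Complex.norm_real, Real.dist_eq, Real.norm_eq_abs, mul_comm]
  refine mul_le_mul_of_nonneg_right ((norm_mul_le _ _).trans ?_) (abs_nonneg _)
  exact mul_le_mul (hM s) (hM t) (norm_nonneg _) hM0

/-- A bounded net of operators which converges on a dense set converges strongly. -/
theorem exists_tendsto_of_dense [CompleteSpace E] {u : ℝ → E →L[ℂ] E} {L : ℝ}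
    (hL : ∀ N : ℝ, 0 ≤ N → ‖u N‖ ≤ L) {s : Set E} (hs : Dense s)
    (hu : ∀ x ∈ s, ∃ y, Tendsto (fun N => u N x) atTop (𝓝 y)) (x : E) :
    ∃ y, Tendsto (fun N => u N x) atTop (𝓝 y) := by
  have hL0 : 0 ≤ L := (norm_nonneg _).trans (hL 0 le_rfl)
  refine cauchy_map_iff_exists_tendsto.1 ?_
  rw [Metric.cauchy_iff]
  refine ⟨inferInstance, fun ε hε => ?_⟩
  obtain ⟨y, hxy, hy⟩ := Metric.dense_iff.1 hs x (ε / (4 * (L + 1))) (by positivity)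
  obtain ⟨l, hl⟩ := hu y hy
  have hev := (eventually_ge_atTop (0 : ℝ)).and (Metric.tendsto_nhds.1 hl (ε / 4) (by positivity))
  refine ⟨_, image_mem_map hev, ?_⟩
  have key : ∀ N : ℝ, 0 ≤ N ∧ dist (u N y) l < ε / 4 → dist (u N x) l < ε / 2 := by
    rintro N ⟨hN, hNl⟩
    have h1 : dist (u N x) (u N y) ≤ L * (ε / (4 * (L + 1))) := by
      rw [dist_eq_norm, ← map_sub]
      refine (u N).le_of_opNorm_le_of_le (hL N hN) ?_
      rw [← dist_eq_norm, dist_comm]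
      exact (Metric.mem_ball.1 hxy).le
    have h2 : L * (ε / (4 * (L + 1))) ≤ ε / 4 := by
      rw [← mul_div_assoc, div_le_div_iff₀ (by positivity) (by positivity)]
      nlinarith
    linarith [dist_triangle (u N x) (u N y) l]
  rintro _ ⟨N, hN, rfl⟩ _ ⟨N', hN', rfl⟩
  have h1 := key N hN
  have h2 := key N' hN'
  linarith [dist_triangle_right (u N x) (u N' x) l]

namespace HasImaginaryResolvent

variable {S : E →ₗ.[ℂ] E} {r : ℝ → E →L[ℂ] E} {M K : ℝ}

theorem nonneg (h : HasImaginaryResolvent S r M K) : 0 ≤ M := by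
  simpa using (norm_nonneg _).trans (h.norm_le 0)

theorem norm_le' (h : HasImaginaryResolvent S r M K) (t : ℝ) : ‖r t‖ ≤ M :=
  (h.norm_le t).trans (div_le_self h.nonneg (by linarith [abs_nonneg t]))

theorem continuous (h : HasImaginaryResolvent S r M K) : Continuous r :=
  continuous_imaginary_resolvent h.isResolventAt h.norm_le'

theorem commute (h : HasImaginaryResolvent S r M K) (s t : ℝ) : Commute (r s) (r t) :=
  (h.isResolventAt s).commute (h.isResolventAt t)

theorem norm_mul_neg_le (h : HasImaginaryResolvent S r M K) (t : ℝ) :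
    ‖r t * r (-t)‖ ≤ M ^ 2 / (1 + t ^ 2) := by
  have h1 := h.norm_le t
  have h2 := h.norm_le (-t)
  rw [abs_neg] at h2
  have hM := h.nonneg
  calc ‖r t * r (-t)‖ ≤ (M / (1 + |t|)) * (M / (1 + |t|)) :=
        (norm_mul_le _ _).trans (mul_le_mul h1 h2 (norm_nonneg _) (by positivity))
    _ = M ^ 2 / (1 + |t|) ^ 2 := by rw [div_mul_div_comm, sq, sq]
    _ ≤ M ^ 2 / (1 + t ^ 2) := by
        gcongr
        nlinarith [abs_nonneg t, sq_abs t]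

theorem continuous_mul_neg (h : HasImaginaryResolvent S r M K) :
    Continuous fun t => r t * r (-t) :=
  h.continuous.mul (h.continuous.comp continuous_neg)

/-- Formally `r t * r (-t) = (S² + t²)⁻¹`, and this is the resolvent identity of `S²`; deriving it
from that of `S` avoids introducing the operator `S²`. -/
theorem mul_neg_sub (h : HasImaginaryResolvent S r M K) (t s : ℝ) :
    r t * r (-t) - r s * r (-s) = (s ^ 2 - t ^ 2) • ((r t * r (-t)) * (r s * r (-s))) := by
  have e : r t * r (-t) - r s * r (-s) =
      (r t - r s) * r (-t) + r s * (r (-t) - r (-s)) := by noncomm_ring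
  have c1 : r t * r s * r (-t) = (r s * r (-t)) * r t := by
    rw [(h.commute t s).eq, mul_assoc, (h.commute t (-t)).eq, mul_assoc]
  have e2 : r t * r (-t) - r s * r (-s) =
      (((t - s : ℝ) : ℂ) * Complex.I) • ((r s * r (-t)) * (r t - r (-s))) := by
    rw [e, imaginary_resolvent_sub h.isResolventAt t s,
      imaginary_resolvent_sub h.isResolventAt (-t) (-s), smul_mul_assoc, c1, mul_smul_comm,
      mul_sub, smul_sub, mul_assoc (r s) (r (-t)) (r (-s)),
      show -t - -s = -(t - s) by ring, Complex.ofReal_neg, neg_mul, neg_smul, ← sub_eq_add_neg]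
  have c2 : r s * r (-t) * (r t * r (-s)) = (r t * r (-t)) * (r s * r (-s)) := by
    rw [← mul_assoc, mul_assoc (r s), (h.commute (-t) t).eq,
      ((h.commute s t).mul_right (h.commute s (-t))).eq, mul_assoc]
  rw [e2, imaginary_resolvent_sub h.isResolventAt t (-s), mul_smul_comm, smul_smul, c2,
    ← Complex.coe_smul]
  congr 1
  push_cast
  linear_combination ((t : ℂ) ^ 2 - (s : ℂ) ^ 2) * Complex.I_sq

/-- Formally `r t + r (-t) = 2 S (S² + t²)⁻¹`, and `r 0 = S⁻¹` removes the factor `S`. For `t ≠ 0`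
both sides are compared after multiplication by `it`. -/
theorem add_neg_mul_zero (h : HasImaginaryResolvent S r M K) (t : ℝ) :
    (r t + r (-t)) * r 0 = (2 : ℝ) • (r t * r (-t)) := by
  by_cases ht : t = 0
  · subst ht
    rw [neg_zero, add_mul, two_smul]
  have h1 := imaginary_resolvent_sub h.isResolventAt t 0
  have h2 := imaginary_resolvent_sub h.isResolventAt (-t) 0
  have h3 := imaginary_resolvent_sub h.isResolventAt t (-t)
  have ht' : ((t : ℂ) * Complex.I) ≠ 0 := by simp [ht]
  refine smul_right_injective _ ht' ?_
  simp only [add_mul, smul_add]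
  rw [sub_zero] at h1 h2
  rw [← h1, ← Complex.coe_smul, smul_smul]
  have h4 : ((t : ℂ) * Complex.I) • (r (-t) * r 0) = r 0 - r (-t) := by
    rw [← neg_sub (r (-t)), h2, ← neg_smul]
    push_cast
    ring_nf
  rw [h4, sub_add_sub_cancel, h3]
  congr 1
  push_cast
  ring

/-- The integral `(2 / π) ∫₀^∞ (S² + t²)⁻¹ dt`, that is, `(S²)^(-1/2)`. -/
noncomputable def invAbs (r : ℝ → E →L[ℂ] E) : E →L[ℂ] E :=
  (2 / Real.pi) • ∫ t in Ioi (0 : ℝ), r t * r (-t)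

theorem integral_symm_eq (h : HasImaginaryResolvent S r M K) (N : ℝ) :
    ∫ t in (-N)..N, r t = ∫ t in (0 : ℝ)..N, (r t + r (-t)) := by
  have hi : ∀ a b, IntervalIntegrable r volume a b := fun a b => h.continuous.intervalIntegrable a b
  have hi' : ∀ a b, IntervalIntegrable (fun t => r (-t)) volume a b := fun a b =>
    (h.continuous.comp continuous_neg).intervalIntegrable a b
  rw [intervalIntegral.integral_add (hi _ _) (hi' _ _), intervalIntegral.integral_comp_neg, neg_zero,
    add_comm, intervalIntegral.integral_add_adjacent_intervals (hi _ _) (hi _ _)]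

theorem norm_smul_integral_le (h : HasImaginaryResolvent S r M K) {N : ℝ} (hN : 0 ≤ N) :
    ‖Real.pi⁻¹ • ∫ t in (-N)..N, r t‖ ≤ Real.pi⁻¹ * K := by
  rw [norm_smul, Real.norm_of_nonneg (by positivity)]
  exact mul_le_mul_of_nonneg_left (h.norm_integral_le N hN) (by positivity)

variable [CompleteSpace E]

/-- The square root formula for `L = S²`; the factor `2 / π` is chosen to cancel `π² / 4`. -/
theorem invAbs_mul_self (h : HasImaginaryResolvent S r M K) :
    invAbs r * invAbs r = r 0 * r 0 := by
  have := integral_mul_integral_eq h.continuous_mul_neg h.norm_mul_neg_le h.mul_neg_sub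
  rw [invAbs, smul_mul_smul_comm, this, smul_smul, neg_zero]
  have hpi := Real.pi_ne_zero
  rw [show 2 / Real.pi * (2 / Real.pi) * (Real.pi ^ 2 / 4) = 1 by field_simp; norm_num, one_smul]

/-- Multiplying by `r 0` improves the decay from `1 / |t|` to `1 / t²` after pairing `t` with `-t`,
so the principal value becomes an absolutely convergent integral, with limit in operator norm. -/
theorem tendsto_integral_mul_zero (h : HasImaginaryResolvent S r M K) :
    Tendsto (fun N : ℝ => (Real.pi⁻¹ • ∫ t in (-N)..N, r t) * r 0) atTop (𝓝 (invAbs r)) := by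
  have e : ∀ N : ℝ, (Real.pi⁻¹ • ∫ t in (-N)..N, r t) * r 0 =
      (2 / Real.pi) • ∫ t in (0 : ℝ)..N, r t * r (-t) := by
    intro N
    rw [h.integral_symm_eq, smul_mul_assoc]
    have hc : Continuous fun t => r t + r (-t) :=
      h.continuous.add (h.continuous.comp continuous_neg)
    have := ((ContinuousLinearMap.mul ℂ (E →L[ℂ] E)).flip (r 0)).intervalIntegral_comp_comm
      (hc.intervalIntegrable (μ := volume) 0 N)
    simp only [ContinuousLinearMap.flip_apply, ContinuousLinearMap.mul_apply'] at this
    rw [← this]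
    simp_rw [h.add_neg_mul_zero]
    rw [intervalIntegral.integral_smul, smul_smul, div_eq_inv_mul]
  simp_rw [e]
  refine Tendsto.const_smul ?_ _
  exact intervalIntegral_tendsto_integral_Ioi 0
    (integrable_of_norm_le_div_one_add_sq h.continuous_mul_neg h.norm_mul_neg_le).integrableOn
    tendsto_id

/-- The strong limit `U = (1 / π) lim ∫_{-N}^N (S - i t)⁻¹ dt`. -/
theorem exists_sign (h : HasImaginaryResolvent S r M K) (hd : Dense (S.domain : Set E)) :
    ∃ U : E →L[ℂ] E,
      ∀ x, Tendsto (fun N : ℝ => (Real.pi⁻¹ • ∫ t in (-N)..N, r t) x) atTop (𝓝 (U x)) := by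
  have hx : ∀ x, ∃ y, Tendsto (fun N : ℝ => (Real.pi⁻¹ • ∫ t in (-N)..N, r t) x) atTop (𝓝 y) := by
    -- Convergence is known on the range of `r 0`, which is dense because it is the domain of `S`;
    -- the uniform bound on the integrals extends it to all vectors.
    refine exists_tendsto_of_dense (fun N hN => h.norm_smul_integral_le hN)
      ((h.isResolventAt 0).denseRange hd) ?_
    rintro _ ⟨y, rfl⟩
    exact ⟨invAbs r y, ((ContinuousLinearMap.apply ℂ E y).continuous.tendsto _).comp
      h.tendsto_integral_mul_zero⟩
  choose g hg using hx
  exact ⟨continuousLinearMapOfTendsto _ (tendsto_pi_nhds.2 hg), hg⟩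

end HasImaginaryResolvent

end ImaginaryResolvent

/-! ### The sign operator as an involution, and the spectral subspaces. -/

section Sign

open MeasureTheory Set Filter Topology

theorem norm_inv_mul_I_sub_le {z : ℂ} (hz : z.re ≠ 0) (t : ℝ) :
    ‖((t : ℂ) * Complex.I - z)⁻¹‖ ≤ ((1 + |z.im|) / |z.re| + 1) / (1 + |t|) := by
  have hz' : 0 < |z.re| := abs_pos.2 hz
  have h1 : |z.re| ≤ ‖(t : ℂ) * Complex.I - z‖ := by
    simpa using Complex.abs_re_le_norm ((t : ℂ) * Complex.I - z)
  have h2 : |t - z.im| ≤ ‖(t : ℂ) * Complex.I - z‖ := by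
    simpa using Complex.abs_im_le_norm ((t : ℂ) * Complex.I - z)
  have h0 : 0 < ‖(t : ℂ) * Complex.I - z‖ := hz'.trans_le h1
  rw [norm_inv, inv_le_comm₀ h0 (by positivity), inv_div, div_le_iff₀ (by positivity)]
  have h3 : |t| ≤ |t - z.im| + |z.im| := by
    simpa using abs_add_le (t - z.im) z.im
  have h4 : 1 + |z.im| ≤ ‖(t : ℂ) * Complex.I - z‖ * ((1 + |z.im|) / |z.re|) := by
    rw [← mul_div_assoc, le_div_iff₀ hz', mul_comm]
    gcongr
  linarith

theorem mul_I_sub_ne_zero {z : ℂ} (hz : z.re ≠ 0) (t : ℝ) : (t : ℂ) * Complex.I - z ≠ 0 := by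
  intro h
  have := congrArg Complex.re h
  simp at this
  exact hz this

theorem continuous_inv_mul_I_sub {z : ℂ} (hz : z.re ≠ 0) :
    Continuous fun t : ℝ => ((t : ℂ) * Complex.I - z)⁻¹ :=
  Continuous.inv₀ (by fun_prop) (mul_I_sub_ne_zero hz)

/-- Since `Re z < 0`, the path `it - z` stays in the right half-plane, where `-i log` is an
antiderivative. The moduli of the endpoints cancel in the limit and the arguments differ by `π`. -/
theorem tendsto_integral_inv_mul_I_sub_of_neg {z : ℂ} (hz : z.re < 0) :
    Tendsto (fun N : ℝ => ∫ t in (-N)..N, ((t : ℂ) * Complex.I - z)⁻¹) atTop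
      (𝓝 (Real.pi : ℂ)) := by
  have hslit : ∀ t : ℝ, (t : ℂ) * Complex.I - z ∈ Complex.slitPlane := fun t =>
    Or.inl (by simpa using hz)
  have hder : ∀ t : ℝ, HasDerivAt (fun t : ℝ => -Complex.I * Complex.log ((t : ℂ) * Complex.I - z))
      (((t : ℂ) * Complex.I - z)⁻¹) t := by
    intro t
    have h1 : HasDerivAt (fun t : ℝ => (t : ℂ) * Complex.I - z) Complex.I t := by
      simpa using (((hasDerivAt_id t).ofReal_comp).mul_const Complex.I).sub_const z
    have h2 := (h1.clog_real (hslit t)).const_mul (-Complex.I)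
    refine h2.congr_deriv ?_
    rw [mul_div_assoc', neg_mul, Complex.I_mul_I, neg_neg, one_div]
  have hint : ∀ N : ℝ, ∫ t in (-N)..N, ((t : ℂ) * Complex.I - z)⁻¹ =
      -Complex.I * Complex.log ((N : ℂ) * Complex.I - z) -
        -Complex.I * Complex.log (((-N : ℝ) : ℂ) * Complex.I - z) := fun N =>
    intervalIntegral.integral_eq_sub_of_hasDerivAt (fun t _ => hder t)
      ((continuous_inv_mul_I_sub hz.ne).intervalIntegrable _ _)
  have hlog : ∀ w : ℂ, w ∈ Complex.slitPlane →
      Tendsto (fun N : ℝ => Complex.log (w - z / N)) atTop (𝓝 (Complex.log w)) := by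
    intro w hw
    refine Tendsto.clog ?_ hw
    have : Tendsto (fun N : ℝ => z / (N : ℂ)) atTop (𝓝 0) := by
      have h0 : Tendsto (fun N : ℝ => ((N⁻¹ : ℝ) : ℂ)) atTop (𝓝 ((0 : ℝ) : ℂ)) :=
        (Complex.continuous_ofReal.tendsto _).comp tendsto_inv_atTop_zero
      simpa [div_eq_mul_inv] using h0.const_mul z
    simpa using tendsto_const_nhds.sub this
  have hlim := ((hlog Complex.I (by simp [Complex.slitPlane])).const_mul (-Complex.I)).sub
    ((hlog (-Complex.I) (by simp [Complex.slitPlane])).const_mul (-Complex.I))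
  rw [Complex.log_I, Complex.log_neg_I] at hlim
  have hpi : -Complex.I * (↑Real.pi / 2 * Complex.I) - -Complex.I * (-(↑Real.pi / 2) * Complex.I)
      = (Real.pi : ℂ) := by
    linear_combination (-(Real.pi : ℂ)) * Complex.I_sq
  rw [hpi] at hlim
  refine hlim.congr' ?_
  filter_upwards [eventually_gt_atTop 0] with N hN
  have hN' : (N : ℂ) ≠ 0 := by exact_mod_cast hN.ne'
  have e1 : (N : ℂ) * Complex.I - z = (N : ℂ) * (Complex.I - z / N) := by field_simp
  have e2 : ((-N : ℝ) : ℂ) * Complex.I - z = (N : ℂ) * (-Complex.I - z / N) := by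
    push_cast; field_simp
  have n1 : Complex.I - z / N ≠ 0 := by
    intro h; exact mul_I_sub_ne_zero hz.ne N (by rw [e1, h, mul_zero])
  have n2 : -Complex.I - z / N ≠ 0 := by
    intro h; exact mul_I_sub_ne_zero hz.ne (-N) (by rw [e2, h, mul_zero])
  -- Factoring out `N` produces the same `log N` at both endpoints, which cancels.
  rw [hint, e1, e2, Complex.log_ofReal_mul hN n1, Complex.log_ofReal_mul hN n2]
  ring

theorem tendsto_integral_inv_mul_I_sub {z : ℂ} {σ : ℝ} (hσ : σ = 1 ∨ σ = -1)
    (hz : σ * z.re < 0) :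
    Tendsto (fun N : ℝ => ∫ t in (-N)..N, ((t : ℂ) * Complex.I - z)⁻¹) atTop
      (𝓝 ((σ : ℂ) * (Real.pi : ℂ))) := by
  rcases hσ with rfl | rfl
  · simpa using tendsto_integral_inv_mul_I_sub_of_neg (z := z) (by simpa using hz)
  · have h := (tendsto_integral_inv_mul_I_sub_of_neg (z := -z) (by simpa using hz)).neg
    have e : ∀ N : ℝ, ∫ t in (-N)..N, ((t : ℂ) * Complex.I - z)⁻¹ =
        -∫ t in (-N)..N, ((t : ℂ) * Complex.I - -z)⁻¹ := by
      intro N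
      have := intervalIntegral.integral_comp_neg (a := -N) (b := N)
        (fun t : ℝ => ((t : ℂ) * Complex.I - z)⁻¹)
      rw [neg_neg] at this
      rw [← this, ← intervalIntegral.integral_neg]
      congr 1
      ext t
      rw [← inv_neg]
      congr 1
      push_cast; ring
    simpa [e] using h

variable {E : Type*} [NormedAddCommGroup E] [NormedSpace ℂ E]

/-- The eigenspace of `U` for the eigenvalue `σ`. -/
noncomputable def signSpace (U : E →L[ℂ] E) (σ : ℝ) : Submodule ℂ E :=
  LinearMap.ker (U - (σ : ℂ) • (1 : E →L[ℂ] E)).toLinearMap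

theorem mem_signSpace {U : E →L[ℂ] E} {σ : ℝ} {x : E} :
    x ∈ signSpace U σ ↔ U x = (σ : ℂ) • x := by
  simp [signSpace, LinearMap.mem_ker, sub_eq_zero]

theorem isClosed_signSpace (U : E →L[ℂ] E) (σ : ℝ) : IsClosed (signSpace U σ : Set E) :=
  ContinuousLinearMap.isClosed_ker (U - (σ : ℂ) • (1 : E →L[ℂ] E))

theorem isCompl_signSpace {U : E →L[ℂ] E} (hU : U * U = 1) :
    IsCompl (signSpace U 1) (signSpace U (-1)) := by
  have hUU : ∀ x, U (U x) = x := fun x => by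
    rw [← mul_apply_eq_comp, hU, one_apply_eq_self]
  constructor
  · rw [Submodule.disjoint_def]
    intro x h1 h2
    rw [mem_signSpace] at h1 h2
    rw [h1] at h2
    have h3 : (2 : ℂ) • x = 0 := by
      rw [two_smul]
      simpa [eq_neg_iff_add_eq_zero] using h2
    simpa using h3
  · rw [codisjoint_iff_le_sup]
    intro x _
    rw [Submodule.mem_sup]
    refine ⟨(2 : ℂ)⁻¹ • (x + U x), ?_, (2 : ℂ)⁻¹ • (x - U x), ?_, ?_⟩
    · simp [mem_signSpace, hUU, add_comm]
    · rw [mem_signSpace, map_smul, map_sub, hUU, smul_comm]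
      simp
    · rw [← smul_add, add_add_sub_cancel, ← two_smul ℂ x, smul_smul]
      simp

theorem commute_intervalIntegral [CompleteSpace E] {r : ℝ → E →L[ℂ] E} (hr : Continuous r)
    {Q : E →L[ℂ] E} (hQ : ∀ t, Commute (r t) Q) (a b : ℝ) : Commute (∫ t in a..b, r t) Q := by
  have h1 := ((ContinuousLinearMap.mul ℂ (E →L[ℂ] E)).flip Q).intervalIntegral_comp_comm
      (hr.intervalIntegrable (μ := volume) a b)
  have h2 := ((ContinuousLinearMap.mul ℂ (E →L[ℂ] E)) Q).intervalIntegral_comp_comm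
      (hr.intervalIntegrable (μ := volume) a b)
  simp only [ContinuousLinearMap.flip_apply, ContinuousLinearMap.mul_apply'] at h1 h2
  rw [Commute, SemiconjBy, ← h1, ← h2]
  simp_rw [(hQ _).eq]

/-- `U` is the strong principal value integral of `(1 / π) r` over the real line. -/
def IsSignOf (U : E →L[ℂ] E) (r : ℝ → E →L[ℂ] E) : Prop :=
  ∀ x, Tendsto (fun N : ℝ => (Real.pi⁻¹ • ∫ t in (-N)..N, r t) x) atTop (𝓝 (U x))

namespace HasImaginaryResolvent

variable {S : E →ₗ.[ℂ] E} {r : ℝ → E →L[ℂ] E} {M K : ℝ} {U : E →L[ℂ] E}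

theorem continuous_inv_smul (h : HasImaginaryResolvent S r M K) {z : ℂ} (hz : z.re ≠ 0) :
    Continuous fun t : ℝ => ((t : ℂ) * Complex.I - z)⁻¹ • r t :=
  (continuous_inv_mul_I_sub hz).smul h.continuous

theorem integrable_inv_smul (h : HasImaginaryResolvent S r M K) {z : ℂ} (hz : z.re ≠ 0) :
    Integrable fun t : ℝ => ((t : ℂ) * Complex.I - z)⁻¹ • r t := by
  refine integrable_of_norm_le_div_one_add_sq (M := ((1 + |z.im|) / |z.re| + 1) * M)
    (h.continuous_inv_smul hz) fun t => ?_
  have hM := h.nonneg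
  rw [norm_smul]
  calc _ ≤ (((1 + |z.im|) / |z.re| + 1) / (1 + |t|)) * (M / (1 + |t|)) :=
        mul_le_mul (norm_inv_mul_I_sub_le hz t) (h.norm_le t) (norm_nonneg _) (by positivity)
    _ = ((1 + |z.im|) / |z.re| + 1) * M / (1 + |t|) ^ 2 := by rw [div_mul_div_comm, sq]
    _ ≤ _ := by
        gcongr
        nlinarith [abs_nonneg t, sq_abs t]

/-- `± (1 / 2π) ∫ (i t - z)⁻¹ (S - i t)⁻¹ dt`, the resolvent of the restrictions to the spectral
subspaces in the half-plane `± Re z < 0`. -/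
noncomputable def halfPlaneResolvent (r : ℝ → E →L[ℂ] E) (σ : ℝ) (z : ℂ) : E →L[ℂ] E :=
  (σ / (2 * Real.pi)) • ∫ t : ℝ, ((t : ℂ) * Complex.I - z)⁻¹ • r t

theorem tendsto_halfPlaneResolvent (h : HasImaginaryResolvent S r M K) (σ : ℝ) {z : ℂ}
    (hz : z.re ≠ 0) :
    Tendsto (fun N : ℝ => (σ / (2 * Real.pi)) • ∫ t in (-N)..N, ((t : ℂ) * Complex.I - z)⁻¹ • r t)
      atTop (𝓝 (halfPlaneResolvent r σ z)) :=
  (intervalIntegral_tendsto_integral (h.integrable_inv_smul hz) tendsto_neg_atTop_atBot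
    tendsto_id).const_smul _

variable [CompleteSpace E]

theorem sign_mul_zero (h : HasImaginaryResolvent S r M K) (hU : IsSignOf U r) :
    U * r 0 = invAbs r := by
  ext x
  exact tendsto_nhds_unique (hU (r 0 x))
    (((ContinuousLinearMap.apply ℂ E x).continuous.tendsto _).comp h.tendsto_integral_mul_zero)

theorem commute_sign (h : HasImaginaryResolvent S r M K) (hU : IsSignOf U r) {Q : E →L[ℂ] E}
    (hQ : ∀ t, Commute (r t) Q) : Commute U Q := by
  ext x
  refine tendsto_nhds_unique (hU (Q x)) ?_
  refine ((Q.continuous.tendsto _).comp (hU x)).congr fun N => ?_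
  have := (commute_intervalIntegral h.continuous hQ (-N) N).smul_left Real.pi⁻¹
  exact (DFunLike.congr_fun this.eq x).symm

/-- `U` commutes with `r 0`, and `U * r 0` has the same square as `r 0`; the two factors `r 0`
cancel because `r 0` is injective. -/
theorem sign_mul_self (h : HasImaginaryResolvent S r M K) (hU : IsSignOf U r) : U * U = 1 := by
  have hc : Commute U (r 0) := h.commute_sign hU fun t => h.commute t 0
  have h1 : (r 0 * r 0) * (U * U) = r 0 * r 0 := by
    calc (r 0 * r 0) * (U * U) = (U * U) * (r 0 * r 0) :=
          ((hc.mul_left hc).mul_right (hc.mul_left hc)).eq.symm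
      _ = (U * r 0) * (U * r 0) := (hc.symm.mul_mul_mul_comm U (r 0)).symm
      _ = r 0 * r 0 := by rw [h.sign_mul_zero hU, h.invAbs_mul_self]
  ext x
  have h2 := DFunLike.congr_fun h1 x
  exact (h.isResolventAt 0).injective ((h.isResolventAt 0).injective h2)

theorem sign_mem_graph (h : HasImaginaryResolvent S r M K) (hU : IsSignOf U r) {x y : E}
    (hxy : (x, y) ∈ S.graph) : (U x, U y) ∈ S.graph := by
  have h0 := h.isResolventAt 0
  have hx : r 0 y = x := by simpa using h0.apply_of_mem_graph hxy
  have h1 := h0.mem_graph (U y)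
  have h2 : r 0 (U y) = U x := by
    rw [← hx]
    exact (DFunLike.congr_fun (h.commute_sign hU fun t => h.commute t 0).eq y).symm
  simpa [h2] using h1

theorem mem_signSpace_of_mem_graph (h : HasImaginaryResolvent S r M K) (hU : IsSignOf U r) {σ : ℝ}
    {x y : E} (hxy : (x, y) ∈ S.graph) (hx : x ∈ signSpace U σ) : y ∈ signSpace U σ := by
  rw [mem_signSpace] at hx ⊢
  have h1 := h.sign_mem_graph hU hxy
  have h2 := S.graph.smul_mem (σ : ℂ) hxy
  rw [hx] at h1
  exact S.mem_graph_snd_inj h1 h2 rfl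

theorem commute_halfPlaneResolvent (h : HasImaginaryResolvent S r M K) (σ : ℝ) {z : ℂ}
    (hz : z.re ≠ 0) {Q : E →L[ℂ] E} (hQ : ∀ t, Commute (r t) Q) :
    Commute (halfPlaneResolvent r σ z) Q := by
  have h1 := h.tendsto_halfPlaneResolvent σ hz
  refine tendsto_nhds_unique (h1.mul_const Q) ((h1.const_mul Q).congr fun N => ?_)
  exact ((commute_intervalIntegral (h.continuous_inv_smul hz)
    (fun t => (hQ t).smul_left _) (-N) N).smul_left (σ / (2 * Real.pi))).eq.symm

/-- From `r t = r 0 + it r 0 r t`, applying `1 - z r 0` to `(it - z)⁻¹ r t` gives `(it - z)⁻¹ r 0 +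
r 0 r t`. The two principal values are `σπ` and `πU`, which combine to the projection `(1 + σU) /
2`. On the eigenspace for `σ` this says that `S - z` is inverted. -/
theorem halfPlaneResolvent_sub (h : HasImaginaryResolvent S r M K) (hU : IsSignOf U r) {σ : ℝ}
    (hσ : σ = 1 ∨ σ = -1) {z : ℂ} (hz : σ * z.re < 0) (x : E) :
    halfPlaneResolvent r σ z x - z • r 0 (halfPlaneResolvent r σ z x) =
      r 0 ((2 : ℂ)⁻¹ • (x + (σ : ℂ) • U x)) := by
  have hz' : z.re ≠ 0 := by rintro h0; simp [h0] at hz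
  have hpt : ∀ t : ℝ, ((t : ℂ) * Complex.I - z)⁻¹ • r t - z • (r 0 * (((t : ℂ) * Complex.I - z)⁻¹ • r t))
      = ((t : ℂ) * Complex.I - z)⁻¹ • r 0 + r 0 * r t := by
    intro t
    have h1 := imaginary_resolvent_sub h.isResolventAt t 0
    rw [sub_zero, (h.commute t 0).eq] at h1
    have h2 := mul_I_sub_ne_zero hz' t
    have h3 : r t = r 0 + ((t : ℂ) * Complex.I) • (r 0 * r t) := by rw [← h1]; abel
    nth_rewrite 1 [h3]
    rw [mul_smul_comm, smul_comm z, smul_add, add_sub_assoc, ← smul_sub, ← sub_smul, smul_smul,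
      inv_mul_cancel₀ h2, one_smul]
  have hint : ∀ N : ℝ, (∫ t in (-N)..N, ((t : ℂ) * Complex.I - z)⁻¹ • r t) -
      z • (r 0 * ∫ t in (-N)..N, ((t : ℂ) * Complex.I - z)⁻¹ • r t) =
      (∫ t in (-N)..N, ((t : ℂ) * Complex.I - z)⁻¹) • r 0 + r 0 * ∫ t in (-N)..N, r t := by
    intro N
    have h1 := (ContinuousLinearMap.id ℂ (E →L[ℂ] E) -
      z • ContinuousLinearMap.mul ℂ (E →L[ℂ] E) (r 0)).intervalIntegral_comp_comm
      ((h.continuous_inv_smul hz').intervalIntegrable (μ := volume) (-N) N)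
    have h2 := (ContinuousLinearMap.mul ℂ (E →L[ℂ] E) (r 0)).intervalIntegral_comp_comm
      (h.continuous.intervalIntegrable (μ := volume) (-N) N)
    simp only [sub_apply, smul_apply, ContinuousLinearMap.id_apply,
      ContinuousLinearMap.mul_apply'] at h1 h2
    rw [← h1, ← h2]
    simp_rw [hpt]
    rw [intervalIntegral.integral_add, intervalIntegral.integral_smul_const]
    · exact ((continuous_inv_mul_I_sub hz').smul continuous_const).intervalIntegrable _ _
    · exact (continuous_const.mul h.continuous).intervalIntegrable _ _
  have hG : Tendsto (fun N : ℝ => ((σ / (2 * Real.pi)) •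
      ∫ t in (-N)..N, ((t : ℂ) * Complex.I - z)⁻¹ • r t) x) atTop
      (𝓝 (halfPlaneResolvent r σ z x)) :=
    ((ContinuousLinearMap.apply ℂ E x).continuous.tendsto _).comp
      (h.tendsto_halfPlaneResolvent σ hz')
  have hL := hG.sub ((((r 0).continuous.tendsto _).comp hG).const_smul z)
  have hR := ((tendsto_integral_inv_mul_I_sub hσ hz).smul_const
    (((σ / (2 * Real.pi) : ℝ) : ℂ) • r 0 x)).add
    ((((r 0).continuous.tendsto _).comp (hU x)).const_smul ((σ : ℂ) / 2))
  refine (tendsto_nhds_unique hL (hR.congr fun N => ?_)).trans ?_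
  · have h1 := congrArg (fun Q : E →L[ℂ] E => ((σ / (2 * Real.pi) : ℝ) : ℂ) • Q x) (hint N)
    simp only [sub_apply, smul_apply, add_apply, mul_apply_eq_comp, smul_sub, smul_add] at h1
    simp only [Function.comp_apply, smul_apply, ← Complex.coe_smul, map_smul]
    rw [smul_comm z, h1, smul_comm (∫ t in (-N)..N, ((t : ℂ) * Complex.I - z)⁻¹), smul_smul ((σ : ℂ) / 2)]
    congr 2
    push_cast
    ring
  · have hπ : (Real.pi : ℂ) ≠ 0 := by exact_mod_cast Real.pi_ne_zero
    have hσ2 : (σ : ℂ) * σ = 1 := by rcases hσ with rfl | rfl <;> simp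
    rw [map_smul, map_add, map_smul, smul_add, smul_smul, smul_smul]
    congr 2
    · push_cast
      field_simp
      linear_combination hσ2
    · ring

/-- Existence of the resolvents of the restrictions to the spectral subspaces. -/
theorem mem_opResolventSet_restrict (h : HasImaginaryResolvent S r M K) (hU : IsSignOf U r) {σ : ℝ}
    (hσ : σ = 1 ∨ σ = -1) {z : ℂ} (hz : σ * z.re ≤ 0) :
    z ∈ opResolventSet (restrict S (signSpace U σ)) := by
  have hmaps : ∀ Q : E →L[ℂ] E, Commute U Q → ∀ x ∈ signSpace U σ, Q x ∈ signSpace U σ := by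
    intro Q hQ x hx
    rw [mem_signSpace] at hx ⊢
    rw [← mul_apply_eq_comp, hQ.eq, mul_apply_eq_comp, hx, map_smul]
  rcases hz.lt_or_eq with hz | hz
  · have hz' : z.re ≠ 0 := by rintro h0; simp [h0] at hz
    have hσ2 : (σ : ℂ) * σ = 1 := by rcases hσ with rfl | rfl <;> simp
    have hproj : ∀ x ∈ signSpace U σ, (2 : ℂ)⁻¹ • (x + (σ : ℂ) • U x) = x := by
      intro x hx
      rw [mem_signSpace.1 hx, smul_smul, hσ2, one_smul, ← two_smul ℂ x, smul_smul]
      simp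
    have hcomm : ∀ t, Commute (halfPlaneResolvent r σ z) (r t) := fun t =>
      h.commute_halfPlaneResolvent σ hz' fun s => h.commute s t
    refine ⟨_, isResolventAt_restrict (halfPlaneResolvent r σ z)
      (hmaps _ (h.commute_sign hU fun t => (hcomm t).symm)) (fun x hx => ?_) fun x hx y hy hxy => ?_⟩
    · have h1 := h.halfPlaneResolvent_sub hU hσ hz x
      rw [hproj x hx, ← map_smul, sub_eq_iff_eq_add, ← map_add] at h1
      have h2 := (h.isResolventAt 0).mem_graph (x + z • halfPlaneResolvent r σ z x)
      rw [← h1] at h2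
      simpa using h2
    · have h1 := h.halfPlaneResolvent_sub hU hσ hz y
      have h2 : r 0 y = x := by simpa using (h.isResolventAt 0).apply_of_mem_graph hxy
      rw [hproj y hy, h2, ← mul_apply_eq_comp, ← (hcomm 0).eq, mul_apply_eq_comp, h2,
        ← map_smul, ← map_sub] at h1
      exact h1
  -- On the axis itself the integral kernel is singular, but there the resolvent of `S` is available
  -- and can be restricted.
  · have hz0 : z.re = 0 := by rcases hσ with rfl | rfl <;> simpa using hz
    have hzi : ((z.im : ℂ) * Complex.I) = z := by
      apply Complex.ext <;> simp [hz0]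
    have hres := h.isResolventAt z.im
    rw [hzi] at hres
    exact ⟨_, isResolventAt_restrict (r z.im) (hmaps _ (h.commute_sign hU fun t => h.commute t _))
      (fun x _ => hres.mem_graph x) fun x _ y _ hxy => hres.apply_of_mem_graph hxy⟩

theorem isDichotomousWith (h : HasImaginaryResolvent S r M K) (hU : IsSignOf U r)
    (hd : Dense (S.domain : Set E)) :
    IsDichotomousWith S (signSpace U 1) (signSpace U (-1)) where
  dense_domain := hd
  isClosed_pos := isClosed_signSpace U 1
  isClosed_neg := isClosed_signSpace U (-1)
  isCompl := isCompl_signSpace (h.sign_mul_self hU)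
  gap := by
    have hM := h.nonneg
    -- A Neumann series around `i Im z` reaches distance `1 / M`; `M + 1` keeps the width meaningful
    -- when `M = 0`.
    refine ⟨(M + 1)⁻¹, by positivity, fun z hz => ?_⟩
    refine (h.isResolventAt z.im).mem_opResolventSet ?_
    have h1 : z - (z.im : ℂ) * Complex.I = (z.re : ℂ) := by
      apply Complex.ext <;> simp
    have hz' : |z.re| < (M + 1)⁻¹ := hz
    rw [h1, Complex.norm_real, Real.norm_eq_abs]
    calc |z.re| * ‖r z.im‖ ≤ |z.re| * (M + 1) :=
          mul_le_mul_of_nonneg_left ((h.norm_le' _).trans (by linarith)) (abs_nonneg _)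
      _ < (M + 1)⁻¹ * (M + 1) := by gcongr
      _ = 1 := inv_mul_cancel₀ (by positivity)
  invariant_pos x hx := h.mem_signSpace_of_mem_graph hU (S.mem_graph x) hx
  invariant_neg x hx := h.mem_signSpace_of_mem_graph hU (S.mem_graph x) hx
  spectrum_pos z hz := by
    by_contra hz'
    exact hz (h.mem_opResolventSet_restrict hU (Or.inl rfl) (by simpa using hz'))
  spectrum_neg z hz := by
    by_contra hz'
    exact hz (h.mem_opResolventSet_restrict hU (Or.inr rfl) (by simpa using hz'))

theorem integral_apply (h : HasImaginaryResolvent S r M K) (a b : ℝ) (x : E) :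
    (∫ t in a..b, r t) x = ∫ t in a..b, r t x :=
  ((ContinuousLinearMap.apply ℂ E x).intervalIntegral_comp_comm
    (h.continuous.intervalIntegrable (μ := volume) a b)).symm

/-- On `x + y` the involution `U` gives `x - y`; the factor `i` from `dz = i dt` cancels against `1
/ (πi)`. -/
theorem hasResolventIntegralProjections (h : HasImaginaryResolvent S r M K) (hU : IsSignOf U r) :
    HasResolventIntegralProjections S (signSpace U 1) (signSpace U (-1)) := by
  intro x hx y hy
  have h1 : U (x + y) = x - y := by
    rw [map_add, mem_signSpace.1 hx, mem_signSpace.1 hy]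
    simp [sub_eq_add_neg]
  rw [← h1]
  refine (hU (x + y)).congr fun N => ?_
  simp_rw [(h.isResolventAt _).opResolvent_eq]
  rw [intervalIntegral.integral_smul, smul_smul, smul_apply, h.integral_apply, ← Complex.coe_smul]
  congr 1
  have hπ : (Real.pi : ℂ) ≠ 0 := by exact_mod_cast Real.pi_ne_zero
  push_cast
  field_simp

end HasImaginaryResolvent

end Sign

/-! ### Sectorially dichotomous operators satisfy the hypotheses on the imaginary axis. -/

section Sectorial

open MeasureTheory Set Filter Topology

variable {E : Type*} [NormedAddCommGroup E] [NormedSpace ℂ E]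

theorem norm_opResolvent_le_two_mul {S : E →ₗ.[ℂ] E} {z w : ℂ} (hz : z ∈ opResolventSet S)
    (hw : w ∈ opResolventSet S) (h : ‖z - w‖ * ‖opResolvent S w‖ ≤ 1 / 2) :
    ‖opResolvent S z‖ ≤ 2 * ‖opResolvent S w‖ := by
  have h1 := (isResolventAt_opResolvent hz).sub_eq (isResolventAt_opResolvent hw)
  have h2 : ‖opResolvent S z‖ ≤ ‖opResolvent S w‖ +
      ‖z - w‖ * (‖opResolvent S z‖ * ‖opResolvent S w‖) := by
    calc ‖opResolvent S z‖ = ‖opResolvent S w + (opResolvent S z - opResolvent S w)‖ := by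
          rw [add_sub_cancel]
      _ ≤ _ := by
          refine (norm_add_le _ _).trans ?_
          rw [h1, norm_smul]
          gcongr
          exact norm_mul_le _ _
  nlinarith [norm_nonneg (opResolvent S z)]

theorem continuousOn_opResolvent {S : E →ₗ.[ℂ] E} {s : Set ℂ} (hs : s ⊆ opResolventSet S) :
    ContinuousOn (opResolvent S) s := by
  intro w hw
  have hlim : Tendsto (fun z : ℂ => ‖z - w‖ * ‖opResolvent S w‖) (𝓝[s] w) (𝓝 0) := by
    have : Continuous fun z : ℂ => ‖z - w‖ * ‖opResolvent S w‖ := by fun_prop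
    simpa using (this.tendsto w).mono_left nhdsWithin_le_nhds
  refine tendsto_iff_norm_sub_tendsto_zero.2 ?_
  have hlim' := hlim.mul_const (2 * ‖opResolvent S w‖)
  rw [zero_mul] at hlim'
  refine squeeze_zero' (Eventually.of_forall fun _ => norm_nonneg _) ?_ hlim'
  filter_upwards [hlim.eventually_le_const (by norm_num : (0 : ℝ) < 1 / 2), self_mem_nhdsWithin]
    with z hz hzs
  rw [(isResolventAt_opResolvent (hs hzs)).sub_eq (isResolventAt_opResolvent (hs hw)), norm_smul,
    mul_assoc]
  gcongr
  refine (norm_mul_le _ _).trans ?_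
  rw [mul_comm]
  gcongr
  exact norm_opResolvent_le_two_mul (hs hzs) (hs hw) hz

theorem differentiableOn_opResolvent {S : E →ₗ.[ℂ] E} {s : Set ℂ} (hs : s ⊆ opResolventSet S) :
    DifferentiableOn ℂ (opResolvent S) s := by
  intro w hw
  refine HasDerivWithinAt.differentiableWithinAt (f' := opResolvent S w * opResolvent S w) ?_
  rw [hasDerivWithinAt_iff_tendsto_slope]
  have h1 : Tendsto (fun z => opResolvent S z * opResolvent S w) (𝓝[s \ {w}] w)
      (𝓝 (opResolvent S w * opResolvent S w)) :=
    ((continuousOn_opResolvent hs w hw).mono_left (nhdsWithin_mono _ sdiff_subset)).mul_const _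
  refine h1.congr' ?_
  filter_upwards [self_mem_nhdsWithin] with z hz
  rw [slope_def_module, (isResolventAt_opResolvent (hs hz.1)).sub_eq
    (isResolventAt_opResolvent (hs hw)), smul_smul, inv_mul_cancel₀, one_smul]
  exact sub_ne_zero.2 hz.2

/-- Cauchy's theorem on rectangles in the left half-plane. -/
theorem norm_integral_opResolvent_le {S : E →ₗ.[ℂ] E} {M : ℝ}
    (hρ : ∀ z : ℂ, z.re ≤ 0 → z ∈ opResolventSet S)
    (hM : ∀ z : ℂ, z ≠ 0 → z.re ≤ 0 → ‖opResolvent S z‖ ≤ M / ‖z‖) (hM0 : 0 ≤ M) {N : ℝ}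
    (hN : 0 ≤ N) : ‖∫ t in (-N)..N, opResolvent S ((t : ℂ) * Complex.I)‖ ≤ 4 * M := by
  rcases hN.eq_or_lt with rfl | hN
  · simpa using hM0
  -- The rectangle is `[-N, 0] × [-N, N]`. Its three sides off the axis have total length `4N` and
  -- lie at distance at least `N` from the origin, so they contribute at most `4M`, whatever `N` is.
  have hrect := Complex.integral_boundary_rect_eq_zero_of_differentiableOn (opResolvent S)
    (⟨-N, -N⟩ : ℂ) (⟨0, N⟩ : ℂ) (differentiableOn_opResolvent fun z hz => hρ z ?_)
  swap
  · have := hz.1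
    rw [uIcc_of_le (by simpa using hN.le)] at this
    exact this.2
  simp only [Complex.ofReal_zero, zero_add] at hrect
  have hb : ∀ z : ℂ, z.re ≤ 0 → N ≤ ‖z‖ → ‖opResolvent S z‖ ≤ M / N := by
    intro z hz hNz
    have hz0 : z ≠ 0 := norm_pos_iff.1 (hN.trans_le hNz)
    exact (hM z hz0 hz).trans (by gcongr)
  have h1 : ‖∫ x in (-N)..0, opResolvent S (x + ((-N : ℝ) : ℂ) * Complex.I)‖ ≤ M / N * |0 - -N| := by
    refine intervalIntegral.norm_integral_le_of_norm_le_const fun x hx => hb _ ?_ ?_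
    · rw [uIoc_of_le (by linarith)] at hx
      simpa using hx.2
    · refine le_trans ?_ (Complex.abs_im_le_norm _)
      simp [abs_of_pos hN]
  have h2 : ‖∫ x in (-N)..0, opResolvent S (x + (N : ℂ) * Complex.I)‖ ≤ M / N * |0 - -N| := by
    refine intervalIntegral.norm_integral_le_of_norm_le_const fun x hx => hb _ ?_ ?_
    · rw [uIoc_of_le (by linarith)] at hx
      simpa using hx.2
    · refine le_trans ?_ (Complex.abs_im_le_norm _)
      simp [abs_of_pos hN]
  have h3 : ‖∫ y in (-N)..N, opResolvent S (((-N : ℝ) : ℂ) + (y : ℂ) * Complex.I)‖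
      ≤ M / N * |N - -N| := by
    refine intervalIntegral.norm_integral_le_of_norm_le_const fun x hx => hb _ ?_ ?_
    · simpa using hN.le
    · refine le_trans ?_ (Complex.abs_re_le_norm _)
      simp [abs_of_pos hN]
  have e : Complex.I • ∫ t in (-N)..N, opResolvent S ((t : ℂ) * Complex.I) =
      Complex.I • (∫ y in (-N)..N, opResolvent S (((-N : ℝ) : ℂ) + (y : ℂ) * Complex.I)) +
      (∫ x in (-N)..0, opResolvent S (x + (N : ℂ) * Complex.I)) -
      ∫ x in (-N)..0, opResolvent S (x + ((-N : ℝ) : ℂ) * Complex.I) := by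
    rw [← sub_eq_zero, ← hrect]
    abel
  have h4 := congrArg norm e
  rw [norm_smul, Complex.norm_I, one_mul] at h4
  rw [h4]
  refine (norm_sub_le _ _).trans ((add_le_add_left (norm_add_le _ _) _).trans ?_)
  rw [norm_smul, Complex.norm_I, one_mul]
  have e1 : M / N * |0 - -N| = M := by rw [zero_sub, neg_neg, abs_of_pos hN]; field_simp
  have e2 : M / N * |N - -N| = 2 * M := by
    rw [sub_neg_eq_add, abs_of_pos (by linarith)]; field_simp; ring
  rw [e1] at h1 h2
  rw [e2] at h3
  linarith

/-- The bound `M / ‖z‖` gives the decay for `|t| ≥ 1`; compactness of `[-1, 1]` covers the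
neighbourhood of zero, where it degenerates. -/
theorem exists_hasImaginaryResolvent_of_left_half_plane {S : E →ₗ.[ℂ] E} {M : ℝ}
    (hρ : ∀ z : ℂ, z.re ≤ 0 → z ∈ opResolventSet S)
    (hM : ∀ z : ℂ, z ≠ 0 → z.re ≤ 0 → ‖opResolvent S z‖ ≤ M / ‖z‖) (hM0 : 0 ≤ M) :
    ∃ r M' K, HasImaginaryResolvent S r M' K := by
  have hax : ∀ t : ℝ, ((t : ℂ) * Complex.I).re ≤ 0 := fun t => by simp
  have hcont : Continuous fun t : ℝ => opResolvent S ((t : ℂ) * Complex.I) := by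
    rw [← continuousOn_univ]
    exact (continuousOn_opResolvent (s := {z : ℂ | z.re ≤ 0}) hρ).comp (by fun_prop)
      fun t _ => hax t
  obtain ⟨C, hC⟩ := (isCompact_Icc (a := (-1 : ℝ)) (b := 1)).exists_bound_of_continuousOn
    hcont.continuousOn
  have hC0 : 0 ≤ C := (norm_nonneg _).trans (hC 0 (by simp))
  refine ⟨fun t => opResolvent S ((t : ℂ) * Complex.I), 2 * (M + C), 4 * M,
    fun t => isResolventAt_opResolvent (hρ _ (hax t)), fun t => ?_,
    fun N hN => norm_integral_opResolvent_le hρ hM hM0 hN⟩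
  rw [le_div_iff₀ (by positivity)]
  rcases le_total |t| 1 with ht | ht
  · have := hC t (abs_le.1 ht)
    nlinarith [norm_nonneg (opResolvent S ((t : ℂ) * Complex.I)), abs_nonneg t]
  · have ht0 : t ≠ 0 := by rintro rfl; norm_num at ht
    have h1 := hM ((t : ℂ) * Complex.I) (by simp [ht0]) (hax t)
    rw [norm_mul, Complex.norm_I, mul_one, Complex.norm_real, Real.norm_eq_abs,
      le_div_iff₀ (by positivity)] at h1
    nlinarith [norm_nonneg (opResolvent S ((t : ℂ) * Complex.I)), abs_nonneg t]

theorem HasImaginaryResolvent.neg {S : E →ₗ.[ℂ] E} {r : ℝ → E →L[ℂ] E} {M K : ℝ}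
    (h : HasImaginaryResolvent S r M K) : HasImaginaryResolvent (-S) (fun t => -r (-t)) M K where
  isResolventAt t := by
    have := (h.isResolventAt (-t)).neg
    simpa using this
  norm_le t := by simpa using h.norm_le (-t)
  norm_integral_le N hN := by
    rw [intervalIntegral.integral_neg, norm_neg, intervalIntegral.integral_comp_neg, neg_neg]
    exact h.norm_integral_le N hN

/-- The resolvent condition is a separate hypothesis because `0` lies in every sector, so
sectoriality alone does not make `S` invertible. The angle `π / 2` is admissible in the resolvent
bound and covers the closed left half-plane without `0`. -/
theorem IsSectorial.exists_hasImaginaryResolvent {S : E →ₗ.[ℂ] E} {θ : ℝ} (hS : IsSectorial S θ)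
    (hθ : θ < Real.pi / 2) (hρ : ∀ z : ℂ, z.re ≤ 0 → z ∈ opResolventSet S) :
    ∃ r M K, HasImaginaryResolvent S r M K := by
  obtain ⟨M, hM0, hM⟩ := hS.resolvent_bound (Real.pi / 2) hθ (by linarith [Real.pi_pos])
  refine exists_hasImaginaryResolvent_of_left_half_plane hρ (fun z hz hre => hM z hz ?_) hM0.le
  by_contra h
  rcases Complex.abs_arg_lt_pi_div_two_iff.1 (not_le.1 h) with h | h
  · exact absurd hre (not_le.2 h)
  · exact hz h

variable {F G W : Type*} [NormedAddCommGroup F] [NormedSpace ℂ F]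
  [NormedAddCommGroup G] [NormedSpace ℂ G] [NormedAddCommGroup W] [NormedSpace ℂ W]

theorem norm_intervalIntegral_comp_comp_le [CompleteSpace F] [CompleteSpace W]
    (L : F →L[ℂ] W) (P : G →L[ℂ] E) {r : ℝ → E →L[ℂ] F} (hr : Continuous r) (a b : ℝ) :
    ‖∫ t in a..b, L.comp ((r t).comp P)‖ ≤ ‖L‖ * (‖∫ t in a..b, r t‖ * ‖P‖) := by
  have h1 := ((ContinuousLinearMap.compL ℂ G F W L).comp
    ((ContinuousLinearMap.compL ℂ G E F).flip P)).intervalIntegral_comp_comm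
      (hr.intervalIntegrable (μ := volume) a b)
  simp only [ContinuousLinearMap.comp_apply, ContinuousLinearMap.flip_apply,
    ContinuousLinearMap.compL_apply] at h1
  rw [h1]
  exact (ContinuousLinearMap.opNorm_comp_le _ _).trans
    (mul_le_mul_of_nonneg_left (ContinuousLinearMap.opNorm_comp_le _ _) (norm_nonneg _))

theorem norm_comp_comp_le (L : F →L[ℂ] W) (P : G →L[ℂ] E) (R : E →L[ℂ] F) :
    ‖L.comp (R.comp P)‖ ≤ ‖L‖ * (‖R‖ * ‖P‖) :=
  (ContinuousLinearMap.opNorm_comp_le _ _).trans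
    (mul_le_mul_of_nonneg_left (ContinuousLinearMap.opNorm_comp_le _ _) (norm_nonneg _))

/-- The resolvent of `A` is the direct sum of the resolvents of its two parts, and the projections
onto closed complements are bounded, so both estimates carry over. -/
theorem IsSectoriallyDichotomous.exists_hasImaginaryResolvent [CompleteSpace E] {A : E →ₗ.[ℂ] E}
    (hA : IsSectoriallyDichotomous A) : ∃ r M K, HasImaginaryResolvent A r M K := by
  obtain ⟨θ, hθ0, hθ, Vp, Vm, hd, hp, hm⟩ := hA
  have : CompleteSpace Vp := hd.isClosed_pos.completeSpace_coe
  have : CompleteSpace Vm := hd.isClosed_neg.completeSpace_coe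
  obtain ⟨rp, Mp, Kp, hrp⟩ := hp.exists_hasImaginaryResolvent hθ fun z hz => by
    by_contra h
    exact absurd hz (not_le.2 (hd.spectrum_pos h))
  obtain ⟨rm', Mm, Km, hrm'⟩ := hm.exists_hasImaginaryResolvent hθ fun z hz => by
    have h1 : -z ∈ opResolventSet (restrict A Vm) := by
      by_contra h
      have : (-z).re < 0 := hd.spectrum_neg h
      simp at this
      linarith
    obtain ⟨R, hR⟩ := h1
    exact ⟨-R, by simpa using hR.neg⟩
  have hrm := hrm'.neg
  rw [neg_neg] at hrm
  generalize (fun t => -rm' (-t)) = rm at hrm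
  have hc := Submodule.IsCompl.isTopCompl_of_isClosed hd.isCompl hd.isClosed_pos hd.isClosed_neg
  set Pp := Vp.projectionOntoL Vm hc with hPp
  set Pm := Vm.projectionOntoL Vp hc.symm with hPm
  have hsum : ∀ x, (Pp x : E) + (Pm x : E) = x := fun x => by
    rw [hPp, hPm]
    simp only [Submodule.coe_projectionOntoL_apply]
    exact Submodule.projection_add_projection_eq_self hd.isCompl x
  obtain ⟨δ, hδ, hgap⟩ := hd.gap
  have hax : ∀ t : ℝ, (t : ℂ) * Complex.I ∈ opResolventSet A := fun t => hgap (by simpa using hδ)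
  refine ⟨fun t => Vp.subtypeL.comp ((rp t).comp Pp) + Vm.subtypeL.comp ((rm t).comp Pm),
    ‖Vp.subtypeL‖ * (Mp * ‖Pp‖) + ‖Vm.subtypeL‖ * (Mm * ‖Pm‖),
    ‖Vp.subtypeL‖ * (Kp * ‖Pp‖) + ‖Vm.subtypeL‖ * (Km * ‖Pm‖), fun t => ?_, fun t => ?_,
    fun N hN => ?_⟩
  · obtain ⟨R, hR⟩ := hax t
    have hgr : ∀ x, ((rp t (Pp x) : E) + (rm t (Pm x) : E),
        x + ((t : ℂ) * Complex.I) • ((rp t (Pp x) : E) + (rm t (Pm x) : E))) ∈ A.graph := by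
      intro x
      have h1 := (mem_graph_restrict A Vp _ _).1 ((hrp.isResolventAt t).mem_graph (Pp x))
      have h2 := (mem_graph_restrict A Vm _ _).1 ((hrm.isResolventAt t).mem_graph (Pm x))
      have h3 := A.graph.add_mem h1 h2
      simp only [Prod.mk_add_mk, Submodule.coe_add, Submodule.coe_smul] at h3
      rwa [add_add_add_comm, hsum, ← smul_add] at h3
    -- The gap already provides a resolvent `R`, so it suffices that the direct sum is a right
    -- inverse.
    have hR' : ∀ x, ((rp t (Pp x) : E) + (rm t (Pm x) : E)) = R x := by
      intro x
      have := hR.apply_of_mem_graph (hgr x)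
      rwa [add_sub_cancel_right, eq_comm] at this
    convert hR
    ext x
    simpa using hR' x
  · refine (norm_add_le _ _).trans ?_
    rw [add_div]
    refine add_le_add ((norm_comp_comp_le _ _ _).trans ?_) ((norm_comp_comp_le _ _ _).trans ?_)
    · rw [mul_div_assoc, mul_div_right_comm]
      gcongr
      exact hrp.norm_le t
    · rw [mul_div_assoc, mul_div_right_comm]
      gcongr
      exact hrm.norm_le t
  · have hcp : Continuous fun t => Vp.subtypeL.comp ((rp t).comp Pp) :=
      continuous_const.clm_comp (hrp.continuous.clm_comp continuous_const)
    have hcm : Continuous fun t => Vm.subtypeL.comp ((rm t).comp Pm) :=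
      continuous_const.clm_comp (hrm.continuous.clm_comp continuous_const)
    rw [intervalIntegral.integral_add (hcp.intervalIntegrable _ _) (hcm.intervalIntegrable _ _)]
    refine (norm_add_le _ _).trans (add_le_add
      ((norm_intervalIntegral_comp_comp_le _ _ hrp.continuous _ _).trans ?_)
      ((norm_intervalIntegral_comp_comp_le _ _ hrm.continuous _ _).trans ?_))
    · gcongr
      exact hrp.norm_integral_le N hN
    · gcongr
      exact hrm.norm_integral_le N hN

end Sectorial

/-! ### Estimates for subordinate perturbations, adjoints and the energy identity. -/

section Perturbation

open MeasureTheory Set Filter Topology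

section Subordinate

variable {E F : Type*} [NormedAddCommGroup E] [NormedSpace ℂ E]
  [NormedAddCommGroup F] [NormedSpace ℂ F]

/-- `Q t` is the product of `R` and the resolvent. Subordination interpolates between `‖r t x‖ ≤ M
‖x‖ / (1 + |t|)` and `‖S (r t x)‖ ≤ (1 + M) ‖x‖`, which leaves the power `-(1 - p)`. -/
theorem IsSubordinate.exists_comp_resolvent {p : ℝ} {R : E →ₗ.[ℂ] F} {S : E →ₗ.[ℂ] E}
    {r : ℝ → E →L[ℂ] E} {M K : ℝ} (hR : IsSubordinate p R S) (h : HasImaginaryResolvent S r M K)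
    (hp0 : 0 ≤ p) (hp1 : p < 1) :
    ∃ c : ℝ, 0 ≤ c ∧ ∃ Q : ℝ → E →L[ℂ] F, (∀ t x, (r t x, Q t x) ∈ R.graph) ∧
      ∀ t, ‖Q t‖ ≤ c * (1 + |t|) ^ (p - 1) := by
  obtain ⟨hdom, c, hc, hbound⟩ := hR
  have hM := h.nonneg
  let Q₀ : ℝ → E →ₗ[ℂ] F := fun t =>
    R.toFun ∘ₗ ((r t).toLinearMap.codRestrict R.domain
      fun x => hdom ((h.isResolventAt t).mem_domain x))
  have hQ₀ : ∀ t x, ‖Q₀ t x‖ ≤ c * M ^ (1 - p) * (1 + M) ^ p * (1 + |t|) ^ (p - 1) * ‖x‖ := by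
    intro t x
    have ht : 0 < 1 + |t| := by positivity
    have h1 := hbound ⟨r t x, (h.isResolventAt t).mem_domain x⟩
    have h2 : ‖r t x‖ ≤ M / (1 + |t|) * ‖x‖ := (r t).le_of_opNorm_le (h.norm_le t) x
    have h3 : ‖S ⟨r t x, (h.isResolventAt t).mem_domain x⟩‖ ≤ (1 + M) * ‖x‖ := by
      rw [sub_eq_iff_eq_add.1 ((h.isResolventAt t).right_inv x)]
      refine (norm_add_le _ _).trans ?_
      rw [norm_smul, norm_mul, Complex.norm_I, mul_one, Complex.norm_real, Real.norm_eq_abs,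
        add_mul, one_mul]
      refine add_le_add le_rfl ?_
      calc |t| * ‖r t x‖ ≤ (1 + |t|) * (M / (1 + |t|) * ‖x‖) := by gcongr; linarith
        _ = M * ‖x‖ := by field_simp
    refine h1.trans ?_
    calc c * ‖r t x‖ ^ (1 - p) * ‖S ⟨r t x, (h.isResolventAt t).mem_domain x⟩‖ ^ p
        ≤ c * (M / (1 + |t|) * ‖x‖) ^ (1 - p) * ((1 + M) * ‖x‖) ^ p := by
          gcongr
      _ = c * M ^ (1 - p) * (1 + M) ^ p * (1 + |t|) ^ (p - 1) * (‖x‖ ^ (1 - p) * ‖x‖ ^ p) := by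
          rw [Real.mul_rpow (by positivity) (norm_nonneg _),
            Real.mul_rpow (by positivity) (norm_nonneg _), Real.div_rpow hM ht.le,
            show p - 1 = -(1 - p) by ring, Real.rpow_neg ht.le]
          field_simp
      _ = _ := by
          rw [← Real.rpow_add_of_nonneg (norm_nonneg _) (by linarith) hp0, sub_add_cancel,
            Real.rpow_one]
  refine ⟨c * M ^ (1 - p) * (1 + M) ^ p, by positivity,
    fun t => (Q₀ t).mkContinuous _ (hQ₀ t), fun t x => ?_, fun t => ?_⟩
  · exact R.mem_graph ⟨r t x, hdom ((h.isResolventAt t).mem_domain x)⟩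
  · exact LinearMap.mkContinuous_norm_le _ (by positivity) _

end Subordinate

section Adjoint

variable {H : Type*} [NormedAddCommGroup H] [InnerProductSpace ℂ H]

/-- The Cauchy-Schwarz inequality for the form of a nonnegative symmetric operator. -/
theorem sq_norm_inner_le_of_nonneg {B : H →ₗ.[ℂ] H} (hB : IsSymmetricOp B)
    (hB0 : IsNonnegativeOp B) {v bv w bw : H} (hv : (v, bv) ∈ B.graph) (hw : (w, bw) ∈ B.graph) :
    ‖inner ℂ bv w‖ ^ 2 ≤ (inner ℂ v bv).re * (inner ℂ w bw).re := by
  let core : PreInnerProductSpace.Core ℂ B.domain :=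
    { inner := fun x y => inner ℂ (x : H) (B y)
      conj_inner_symm := fun x y => by
        change (starRingEnd ℂ) (inner ℂ (y : H) (B x)) = inner ℂ (x : H) (B y)
        rw [inner_conj_symm]
        exact hB.2 x y
      re_inner_nonneg := fun x => hB0 x
      add_left := fun x y z => by
        change inner ℂ ((x + y : B.domain) : H) (B z) = _
        rw [Submodule.coe_add, inner_add_left]
      smul_left := fun x y a => by
        change inner ℂ ((a • x : B.domain) : H) (B y) = _
        rw [Submodule.coe_smul, inner_smul_left] }
  obtain ⟨x, rfl, rfl⟩ := (LinearPMap.mem_graph_iff B).1 hv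
  obtain ⟨y, rfl, rfl⟩ := (LinearPMap.mem_graph_iff B).1 hw
  have h := @InnerProductSpace.Core.inner_mul_inner_self_le ℂ B.domain _ _ _ core x y
  have e1 : inner ℂ (B x) (y : H) = inner ℂ (x : H) (B y) := hB.2 x y
  have e2 : ‖inner ℂ (y : H) (B x)‖ = ‖inner ℂ (x : H) (B y)‖ := by
    rw [← e1, norm_inner_symm]
  rw [e1, sq]
  nth_rewrite 2 [← e2]
  exact h

/-- Here `a = -s*`. Testing the Cauchy-Schwarz inequality of the form of `B` with `w = s (a bv)`
turns its left side into the fourth power of `‖a bv‖`, while `(Bw | w)` costs only `‖s‖ ‖Q‖ ‖a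
bv‖²`. The unbounded vector `bv` is thus controlled by its energy. -/
theorem sq_norm_apply_le_of_nonneg {B : H →ₗ.[ℂ] H} (hB : IsSymmetricOp B)
    (hB0 : IsNonnegativeOp B) {a s Q : H →L[ℂ] H}
    (has : ∀ x y, inner ℂ (a x) y = -inner ℂ x (s y)) (hQ : ∀ y, (s y, Q y) ∈ B.graph)
    {v bv : H} (hv : (v, bv) ∈ B.graph) :
    ‖a bv‖ ^ 2 ≤ ‖s‖ * ‖Q‖ * (inner ℂ v bv).re := by
  have hβ : 0 ≤ (inner ℂ v bv).re := by
    obtain ⟨x, rfl, rfl⟩ := (LinearPMap.mem_graph_iff B).1 hv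
    exact hB0 x
  set n := ‖a bv‖ with hn
  have h1 : ‖inner ℂ bv (s (a bv))‖ = n ^ 2 := by
    have := has bv (a bv)
    rw [← norm_neg, ← this, inner_self_eq_norm_sq_to_K]
    simp [hn]
  have h2 := sq_norm_inner_le_of_nonneg hB hB0 hv (hQ (a bv))
  rw [h1] at h2
  have h3 : (inner ℂ (s (a bv)) (Q (a bv))).re ≤ (‖s‖ * n) * (‖Q‖ * n) :=
    ((Complex.re_le_norm _).trans (norm_inner_le_norm _ _)).trans
      (mul_le_mul (s.le_opNorm _) (Q.le_opNorm _) (norm_nonneg _) (by positivity))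
  rcases (norm_nonneg (a bv)).eq_or_lt with h0 | h0
  · have h5 : n = 0 := h0.symm
    rw [h5]
    simpa using mul_nonneg (by positivity) hβ
  · have h4 : n ^ 2 * n ^ 2 ≤ (‖s‖ * ‖Q‖ * (inner ℂ v bv).re) * n ^ 2 := by
      calc n ^ 2 * n ^ 2 = (n ^ 2) ^ 2 := by ring
        _ ≤ (inner ℂ v bv).re * ((‖s‖ * n) * (‖Q‖ * n)) :=
          h2.trans (mul_le_mul_of_nonneg_left h3 hβ)
        _ = _ := by ring
    exact le_of_mul_le_mul_right h4 (by positivity)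

variable [CompleteSpace H]

theorem mem_graph_adjoint_iff {A : H →ₗ.[ℂ] H} (hd : Dense (A.domain : Set H)) {x y : H} :
    (x, y) ∈ A†.graph ↔ ∀ u w, (u, w) ∈ A.graph → inner ℂ w x = inner ℂ u y := by
  rw [LinearPMap.adjoint_graph_eq_graph_adjoint hd, Submodule.mem_adjoint_iff]
  simp only [sub_eq_zero]

theorem IsResolventAt.adjoint {A : H →ₗ.[ℂ] H} {z : ℂ} {R : H →L[ℂ] H}
    (h : IsResolventAt A z R) (hd : Dense (A.domain : Set H)) :
    IsResolventAt (A†) (starRingEnd ℂ z) (ContinuousLinearMap.adjoint R) := by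
  refine isResolventAt_of_graph (fun x => ?_) fun x y hxy => ?_
  · rw [mem_graph_adjoint_iff hd]
    intro u w huw
    rw [inner_add_right, inner_smul_right, ContinuousLinearMap.adjoint_inner_right,
      ContinuousLinearMap.adjoint_inner_right]
    have h1 : w = (w - z • u) + z • u := by abel
    have h2 := h.apply_of_mem_graph huw
    nth_rewrite 1 [h1]
    rw [map_add, map_smul, h2, inner_add_left, inner_smul_left]
  · refine ext_inner_left ℂ fun w => ?_
    rw [ContinuousLinearMap.adjoint_inner_right, inner_sub_right, inner_smul_right,
      ← (mem_graph_adjoint_iff hd).1 hxy _ _ (h.mem_graph w), inner_add_left, inner_smul_left]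
    ring

/-- Conjugation sends `it` to `-it` and the change of sign sends it back, so `-A*` has resolvents on
the same axis, with the same constants. -/
theorem HasImaginaryResolvent.neg_adjoint {A : H →ₗ.[ℂ] H} {r : ℝ → H →L[ℂ] H} {M K : ℝ}
    (h : HasImaginaryResolvent A r M K) (hd : Dense (A.domain : Set H)) :
    HasImaginaryResolvent (-A†) (fun t => -ContinuousLinearMap.adjoint (r t)) M K where
  isResolventAt t := by
    have := ((h.isResolventAt t).adjoint hd).neg
    simpa using this
  norm_le t := by simpa using h.norm_le t
  norm_integral_le N hN := by
    have h1 := ((starL' ℝ : (H →L[ℂ] H) ≃L[ℝ] (H →L[ℂ] H)) :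
      (H →L[ℂ] H) →L[ℝ] (H →L[ℂ] H)).intervalIntegral_comp_comm
      (h.continuous.intervalIntegrable (μ := volume) (-N) N)
    simp only [ContinuousLinearEquiv.coe_coe, starL'_apply,
      ContinuousLinearMap.star_eq_adjoint] at h1
    rw [intervalIntegral.integral_neg, norm_neg, h1, LinearIsometryEquiv.norm_map]
    exact h.norm_integral_le N hN

end Adjoint

section Hamiltonian

variable {H : Type*} [NormedAddCommGroup H] [InnerProductSpace ℂ H] [CompleteSpace H]

theorem mem_graph_hamiltonian {A B C : H →ₗ.[ℂ] H} {u v f g : H} :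
    ((u, v), (f, g)) ∈ (hamiltonian A B C).graph ↔ ∃ au bv cu dv, (u, au) ∈ A.graph ∧
      (v, bv) ∈ B.graph ∧ (u, cu) ∈ C.graph ∧ (v, dv) ∈ A†.graph ∧
      f = au + bv ∧ g = cu - dv := by
  constructor
  · intro h
    obtain ⟨⟨⟨u', v'⟩, hx⟩, h1, h2⟩ := (LinearPMap.mem_graph_iff _).1 h
    simp only [Prod.mk.injEq] at h1
    obtain ⟨rfl, rfl⟩ := h1
    refine ⟨_, _, _, _, A.mem_graph ⟨u', hx.1.1⟩, B.mem_graph ⟨v', hx.2.1⟩,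
      C.mem_graph ⟨u', hx.1.2⟩, A†.mem_graph ⟨v', hx.2.2⟩, ?_, ?_⟩
    · exact (congrArg Prod.fst h2).symm
    · rw [sub_eq_add_neg]
      exact (congrArg Prod.snd h2).symm
  · rintro ⟨au, bv, cu, dv, hA, hB, hC, hD, rfl, rfl⟩
    obtain ⟨⟨a, ha⟩, rfl, rfl⟩ := (LinearPMap.mem_graph_iff A).1 hA
    obtain ⟨⟨b, hb⟩, rfl, rfl⟩ := (LinearPMap.mem_graph_iff B).1 hB
    obtain ⟨⟨c, hc⟩, rfl : c = a, rfl⟩ := (LinearPMap.mem_graph_iff C).1 hC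
    obtain ⟨⟨d, hd⟩, rfl : d = b, rfl⟩ := (LinearPMap.mem_graph_iff _).1 hD
    refine (LinearPMap.mem_graph_iff _).2 ⟨⟨(c, d), ⟨ha, hc⟩, ⟨hb, hd⟩⟩, rfl, ?_⟩
    rw [sub_eq_add_neg]
    rfl

/-- In the real part the terms of `A` and `A*` cancel by adjointness, and the terms in `t` cancel
because `(v | u) + (u | v)` is real. -/
theorem energy_eq {A : H →ₗ.[ℂ] H} (hd : Dense (A.domain : Set H)) (t : ℝ) {u v au bv cu dv : H}
    (hA : (u, au) ∈ A.graph) (hD : (v, dv) ∈ A†.graph) :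
    (inner ℂ v (au + bv - ((t : ℂ) * Complex.I) • u)).re +
      (inner ℂ u (cu - dv - ((t : ℂ) * Complex.I) • v)).re =
      (inner ℂ v bv).re + (inner ℂ u cu).re := by
  have h1 := (mem_graph_adjoint_iff hd).1 hD u au hA
  have h2 : (inner ℂ v au).re = (inner ℂ u dv).re := by
    rw [← h1, ← inner_conj_symm v au, Complex.conj_re]
  have h3 : (inner ℂ v u).im = -(inner ℂ u v).im := by
    rw [← inner_conj_symm v u, Complex.conj_im]
  simp only [inner_sub_right, inner_add_right, inner_smul_right, Complex.sub_re, Complex.add_re,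
    Complex.mul_re, Complex.mul_im, Complex.ofReal_re, Complex.ofReal_im, Complex.I_re,
    Complex.I_im]
  rw [h2, h3]
  ring

end Hamiltonian

end Perturbation

/-! ### The resolvent of the Hamiltonian on the imaginary axis. -/

section HamiltonianResolvent

open MeasureTheory Set Filter Topology

section General

variable {E : Type*} [NormedAddCommGroup E] [NormedSpace ℂ E]

/-- A lower bound makes `S - z` injective, so any bounded right inverse is two-sided. -/
theorem isResolventAt_of_norm_le {S : E →ₗ.[ℂ] E} {z : ℂ} {k : ℝ} {R : E →L[ℂ] E}
    (hk : ∀ x y, (x, y) ∈ S.graph → ‖x‖ ≤ k * ‖y - z • x‖)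
    (hR : ∀ x, (R x, x + z • R x) ∈ S.graph) : IsResolventAt S z R := by
  refine isResolventAt_of_graph hR fun x y hxy => ?_
  have h1 := hk _ _ (S.graph.sub_mem (hR (y - z • x)) hxy)
  have h2 : y - z • x + z • R (y - z • x) - y - z • (R (y - z • x) - x) = 0 := by
    rw [smul_sub]; abel
  rw [h2, norm_zero, mul_zero] at h1
  exact sub_eq_zero.1 (norm_le_zero_iff.1 h1)

theorem IsResolventAt.norm_le {S : E →ₗ.[ℂ] E} {z : ℂ} {k : ℝ} {R : E →L[ℂ] E}
    (h : IsResolventAt S z R) (hk0 : 0 ≤ k)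
    (hk : ∀ x y, (x, y) ∈ S.graph → ‖x‖ ≤ k * ‖y - z • x‖) : ‖R‖ ≤ k := by
  refine ContinuousLinearMap.opNorm_le_bound _ hk0 fun x => ?_
  simpa using hk _ _ (h.mem_graph x)

variable [CompleteSpace E]

/-- If a uniform lower bound for `S - z` holds on the imaginary axis and one of its points belongs
to the resolvent set, then all of its points do. -/
theorem mem_opResolventSet_of_norm_le {S : E →ₗ.[ℂ] E} {k : ℝ} (hk0 : 0 < k)
    (hk : ∀ (t : ℝ) x y, (x, y) ∈ S.graph → ‖x‖ ≤ k * ‖y - ((t : ℂ) * Complex.I) • x‖) {t₀ : ℝ}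
    (ht₀ : (t₀ : ℂ) * Complex.I ∈ opResolventSet S) (t : ℝ) :
    (t : ℂ) * Complex.I ∈ opResolventSet S := by
  set Z : Set ℝ := {t | (t : ℂ) * Complex.I ∈ opResolventSet S} with hZ
  -- The Neumann radius `k⁻¹` is uniform in `t`, so the set is both open and closed in the connected
  -- real line.
  have hball : ∀ t ∈ Z, ∀ s : ℝ, |s - t| < k⁻¹ → s ∈ Z := by
    rintro t ⟨R, hR⟩ s hs
    refine hR.mem_opResolventSet ?_
    rw [← sub_mul, norm_mul, Complex.norm_I, mul_one, ← Complex.ofReal_sub, Complex.norm_real,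
      Real.norm_eq_abs]
    calc |s - t| * ‖R‖ ≤ |s - t| * k := by
          gcongr
          exact hR.norm_le hk0.le (hk t)
      _ < k⁻¹ * k := by gcongr
      _ = 1 := inv_mul_cancel₀ hk0.ne'
  have hclopen : IsClopen Z := by
    constructor
    · rw [← isOpen_compl_iff, Metric.isOpen_iff]
      refine fun t ht => ⟨k⁻¹, by positivity, fun s hs hsZ => ht (hball s hsZ t ?_)⟩
      rwa [Metric.mem_ball, dist_comm, Real.dist_eq] at hs
    · rw [Metric.isOpen_iff]
      refine fun t ht => ⟨k⁻¹, by positivity, fun s hs => hball t ht s ?_⟩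
      rwa [Metric.mem_ball, Real.dist_eq] at hs
  have ht : t ∈ Z := hclopen.eq_univ ⟨t₀, ht₀⟩ ▸ mem_univ t
  exact ht

end General

variable {H : Type*} [NormedAddCommGroup H] [InnerProductSpace ℂ H] [CompleteSpace H]

/-- Young's inequality, with weights such that the term `X / 2` can be absorbed into `X` later. -/
theorem le_half_add_of_sq_le {n κ X F : ℝ} (hκ : 0 ≤ κ) (hX : 0 ≤ X) (hF : 0 ≤ F)
    (h : n ^ 2 ≤ κ * (2 * X * F)) : n ≤ X / 2 + κ * F := by
  refine (le_abs_self n).trans (abs_le_of_sq_le_sq ?_ (by positivity))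
  nlinarith [sq_nonneg (X / 2 - κ * F)]

theorem rpow_sub_one_le_one {p : ℝ} (hp1 : p < 1) (t : ℝ) : (1 + |t|) ^ (p - 1) ≤ 1 :=
  Real.rpow_le_one_of_one_le_of_nonpos (by linarith [abs_nonneg t]) (by linarith)

variable {A B C : H →ₗ.[ℂ] H} {a QB QC : ℝ → H →L[ℂ] H} {M K c p : ℝ}

/-- The lower bound for `T - i t`, a consequence of the energy identity. -/
theorem norm_le_of_mem_graph_hamiltonian (hT : IsNonnegativeHamiltonian A B C)
    (ha : HasImaginaryResolvent A a M K) (hc : 0 ≤ c) (hp1 : p < 1)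
    (hQB : ∀ t x, (-ContinuousLinearMap.adjoint (a t) x, QB t x) ∈ B.graph)
    (hQB' : ∀ t, ‖QB t‖ ≤ c * (1 + |t|) ^ (p - 1))
    (hQC : ∀ t x, (a t x, QC t x) ∈ C.graph) (hQC' : ∀ t, ‖QC t‖ ≤ c * (1 + |t|) ^ (p - 1))
    (t : ℝ) (x y : H × H) (hxy : (x, y) ∈ (hamiltonian A B C).graph) :
    ‖x‖ ≤ 2 * (M + M * c) / (1 + |t|) * ‖y - ((t : ℂ) * Complex.I) • x‖ := by
  obtain ⟨u, v⟩ := x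
  obtain ⟨f', g'⟩ := y
  obtain ⟨au, bv, cu, dv, hA, hB, hC, hD, rfl, rfl⟩ := mem_graph_hamiltonian.1 hxy
  have hM := ha.nonneg
  have hs := ha.neg_adjoint hT.dense_A
  have ht : 0 < 1 + |t| := by positivity
  set f := au + bv - ((t : ℂ) * Complex.I) • u with hf
  set g := cu - dv - ((t : ℂ) * Complex.I) • v with hg
  have hen := energy_eq hT.dense_A t (bv := bv) (cu := cu) hA hD
  rw [← hf, ← hg] at hen
  have e0 : ((au + bv, cu - dv) : H × H) - ((t : ℂ) * Complex.I) • ((u, v) : H × H) = (f, g) := rfl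
  rw [e0]
  set X := ‖((u, v) : H × H)‖ with hX
  set F := ‖((f, g) : H × H)‖ with hF
  have hX0 : 0 ≤ X := norm_nonneg _
  have hF0 : 0 ≤ F := norm_nonneg _
  have huX : ‖u‖ ≤ X := norm_fst_le ((u, v) : H × H)
  have hvX : ‖v‖ ≤ X := norm_snd_le ((u, v) : H × H)
  have hfF : ‖f‖ ≤ F := norm_fst_le ((f, g) : H × H)
  have hgF : ‖g‖ ≤ F := norm_snd_le ((f, g) : H × H)
  have hβ : 0 ≤ (inner ℂ v bv).re := by
    obtain ⟨x, rfl, rfl⟩ := (LinearPMap.mem_graph_iff B).1 hB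
    exact hT.nonneg_B x
  have hγ : 0 ≤ (inner ℂ u cu).re := by
    obtain ⟨x, rfl, rfl⟩ := (LinearPMap.mem_graph_iff C).1 hC
    exact hT.nonneg_C x
  -- The energy identity bounds both nonnegative forms at once by the product of the norms of `(u,
  -- v)` and `(f, g)`.
  have hsum : (inner ℂ v bv).re + (inner ℂ u cu).re ≤ 2 * X * F := by
    rw [← hen]
    have h1 := (Complex.re_le_norm _).trans (norm_inner_le_norm (𝕜 := ℂ) v f)
    have h2 := (Complex.re_le_norm _).trans (norm_inner_le_norm (𝕜 := ℂ) u g)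
    have h3 : ‖v‖ * ‖f‖ ≤ X * F := by gcongr
    have h4 : ‖u‖ * ‖g‖ ≤ X * F := by gcongr
    linarith
  have hκ : ∀ Q s : H →L[ℂ] H, ‖Q‖ ≤ c * (1 + |t|) ^ (p - 1) → ‖s‖ ≤ M / (1 + |t|) →
      ‖s‖ * ‖Q‖ ≤ M * c / (1 + |t|) := by
    intro Q s hQ hs
    have : ‖Q‖ ≤ c := hQ.trans (mul_le_of_le_one_right hc (rpow_sub_one_le_one hp1 t))
    calc ‖s‖ * ‖Q‖ ≤ M / (1 + |t|) * c := by gcongr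
      _ = _ := by ring
  -- The rows of the equation read `u = a t (f - Bv)` and `v = -(a t)* (g - Cu)`. The inhomogeneity
  -- is handled by resolvent decay, and the coupling term by its energy.
  have key : ∀ b h : H, ∀ s : H →L[ℂ] H, ‖h‖ ≤ F → ‖s‖ ≤ M / (1 + |t|) →
      ‖s b‖ ^ 2 ≤ M * c / (1 + |t|) * (2 * X * F) →
      ‖s (h - b)‖ ≤ M / (1 + |t|) * F + (X / 2 + M * c / (1 + |t|) * F) := by
    intro b h s hh hs hb
    rw [map_sub]
    refine (norm_sub_le _ _).trans (add_le_add ?_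
      (le_half_add_of_sq_le (by positivity) hX0 hF0 hb))
    exact (s.le_of_opNorm_le hs h).trans (by gcongr)
  have hu : ‖u‖ ≤ M / (1 + |t|) * F + (X / 2 + M * c / (1 + |t|) * F) := by
    have h1 : a t (f - bv) = u := by
      have := (ha.isResolventAt t).apply_of_mem_graph hA
      rwa [show f - bv = au - ((t : ℂ) * Complex.I) • u by rw [hf]; abel]
    rw [← h1]
    refine key bv f (a t) hfF (ha.norm_le t) ?_
    have h2 := sq_norm_apply_le_of_nonneg hT.symm_B hT.nonneg_B (a := a t)
      (s := -ContinuousLinearMap.adjoint (a t)) (Q := QB t) (fun x y => by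
        rw [neg_apply, inner_neg_right, neg_neg, ContinuousLinearMap.adjoint_inner_right])
      (fun y => by simpa using hQB t y) hB
    refine h2.trans ?_
    gcongr
    · exact hκ _ _ (hQB' t) (hs.norm_le t)
    · linarith
  have hv : ‖v‖ ≤ M / (1 + |t|) * F + (X / 2 + M * c / (1 + |t|) * F) := by
    have h1 : (-ContinuousLinearMap.adjoint (a t)) (g - cu) = v := by
      have := (hs.isResolventAt t).apply_of_mem_graph (x := v) (y := -dv)
        (mem_graph_neg.2 (by simpa using hD))
      rwa [show g - cu = -dv - ((t : ℂ) * Complex.I) • v by rw [hg]; abel]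
    rw [← h1]
    refine key cu g _ hgF (hs.norm_le t) ?_
    have h2 := sq_norm_apply_le_of_nonneg hT.symm_C hT.nonneg_C
      (a := -ContinuousLinearMap.adjoint (a t)) (s := a t) (Q := QC t) (fun x y => by
        rw [neg_apply, inner_neg_left, ContinuousLinearMap.adjoint_inner_left])
      (fun y => hQC t y) hC
    refine h2.trans ?_
    gcongr
    · exact hκ _ _ (hQC' t) (ha.norm_le t)
    · linarith
  have hmax : X ≤ M / (1 + |t|) * F + (X / 2 + M * c / (1 + |t|) * F) := by
    rw [hX, Prod.norm_def]
    exact max_le hu hv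
  have e : 2 * (M + M * c) / (1 + |t|) * F = 2 * (M / (1 + |t|) * F + M * c / (1 + |t|) * F) := by
    ring
  rw [e]
  linarith

/-- With `R₀` the resolvent of `diag(A, -A*)` one has `(T - it) R₀ = 1 + P`, where `P` decays like
`|t|^(p-1)`. For large `t` this is invertible; the uniform lower bound carries invertibility along
the whole axis. -/
theorem hasImaginaryResolvent_hamiltonian (hT : IsNonnegativeHamiltonian A B C)
    (ha : HasImaginaryResolvent A a M K) (hc : 0 ≤ c) (hp1 : p < 1)
    (hQB : ∀ t x, (-ContinuousLinearMap.adjoint (a t) x, QB t x) ∈ B.graph)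
    (hQB' : ∀ t, ‖QB t‖ ≤ c * (1 + |t|) ^ (p - 1))
    (hQC : ∀ t x, (a t x, QC t x) ∈ C.graph) (hQC' : ∀ t, ‖QC t‖ ≤ c * (1 + |t|) ^ (p - 1)) :
    ∃ r M' K', HasImaginaryResolvent (hamiltonian A B C) r M' K' := by
  have hM := ha.nonneg
  have hs := ha.neg_adjoint hT.dense_A
  have hlow := norm_le_of_mem_graph_hamiltonian hT ha hc hp1 hQB hQB' hQC hQC'
  set s : ℝ → H →L[ℂ] H := fun t => -ContinuousLinearMap.adjoint (a t) with hsdef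
  set k := 2 * (M + M * c) with hk
  have hk0 : 0 ≤ k := by positivity
  -- the unperturbed resolvent and the relative perturbation
  set R₀ : ℝ → (H × H) →L[ℂ] (H × H) := fun t =>
    (ContinuousLinearMap.inl ℂ H H).comp ((a t).comp (ContinuousLinearMap.fst ℂ H H)) +
    (ContinuousLinearMap.inr ℂ H H).comp ((s t).comp (ContinuousLinearMap.snd ℂ H H)) with hR₀
  set P : ℝ → (H × H) →L[ℂ] (H × H) := fun t =>
    ((QB t).comp (ContinuousLinearMap.snd ℂ H H)).prod
      ((QC t).comp (ContinuousLinearMap.fst ℂ H H)) with hP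
  have hPn : ∀ t, ‖P t‖ ≤ c * (1 + |t|) ^ (p - 1) := by
    intro t
    refine ContinuousLinearMap.opNorm_le_bound _ (by positivity) fun x => ?_
    refine max_le ?_ ?_
    · exact ((QB t).le_of_opNorm_le (hQB' t) x.2).trans (by gcongr; exact norm_snd_le x)
    · exact ((QC t).le_of_opNorm_le (hQC' t) x.1).trans (by gcongr; exact norm_fst_le x)
  have hgr : ∀ t w, (R₀ t w, w + P t w + ((t : ℂ) * Complex.I) • R₀ t w) ∈
      (hamiltonian A B C).graph := by
    intro t w
    have e1 : R₀ t w = (a t w.1, s t w.2) := by simp [hR₀]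
    have e2 : w + P t w + ((t : ℂ) * Complex.I) • R₀ t w =
        ((w.1 + ((t : ℂ) * Complex.I) • a t w.1) + QB t w.2,
          QC t w.1 - -(w.2 + ((t : ℂ) * Complex.I) • s t w.2)) := by
      rw [e1]
      refine Prod.ext ?_ ?_
      · change w.1 + QB t w.2 + ((t : ℂ) * Complex.I) • a t w.1 = _
        abel_nf
      · change w.2 + QC t w.1 + ((t : ℂ) * Complex.I) • s t w.2 = _
        dsimp only
        abel
    rw [e2, e1]
    refine mem_graph_hamiltonian.2 ⟨_, _, _, _, (ha.isResolventAt t).mem_graph w.1,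
      ?_, hQC t w.1, mem_graph_neg.1 ((hs.isResolventAt t).mem_graph w.2), rfl, rfl⟩
    simpa [hsdef] using hQB t w.2
  -- a point of the resolvent set
  have hbase : ∃ t₀ : ℝ, (t₀ : ℂ) * Complex.I ∈ opResolventSet (hamiltonian A B C) := by
    have hlim : Tendsto (fun t : ℝ => c * (1 + t) ^ (p - 1)) atTop (𝓝 (c * 0)) := by
      refine Tendsto.const_mul c ?_
      have h1 := (tendsto_rpow_neg_atTop (y := 1 - p) (by linarith)).comp
        (tendsto_atTop_add_const_left atTop (1 : ℝ) tendsto_id)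
      refine h1.congr fun t => ?_
      simp
    rw [mul_zero] at hlim
    obtain ⟨t₀, h1, h2⟩ := ((hlim.eventually_lt_const one_pos).and (eventually_ge_atTop 0)).exists
    refine ⟨t₀, ?_⟩
    have hP1 : ‖-P t₀‖ < 1 := by
      rw [ContinuousLinearMap.opNorm_neg]
      refine (hPn t₀).trans_lt ?_
      rwa [abs_of_nonneg h2]
    set w := Units.oneSub (-P t₀) hP1 with hw
    refine ⟨(R₀ t₀).comp (w⁻¹ : ((H × H) →L[ℂ] (H × H))ˣ).1,
      isResolventAt_of_norm_le (hlow t₀) fun x => ?_⟩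
    have h3 := hgr t₀ ((w⁻¹ : ((H × H) →L[ℂ] (H × H))ˣ).1 x)
    have h4 : (w⁻¹ : ((H × H) →L[ℂ] (H × H))ˣ).1 x +
        P t₀ ((w⁻¹ : ((H × H) →L[ℂ] (H × H))ˣ).1 x) = x := by
      have h5 := DFunLike.congr_fun w.mul_inv x
      rw [mul_apply_eq_comp, hw, Units.val_oneSub, sub_neg_eq_add, add_apply] at h5
      exact h5
    rwa [h4] at h3
  obtain ⟨t₀, ht₀⟩ := hbase
  have hall : ∀ t : ℝ, (t : ℂ) * Complex.I ∈ opResolventSet (hamiltonian A B C) := by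
    -- `k + 1` replaces `k` since a strictly positive constant is needed.
    refine mem_opResolventSet_of_norm_le (k := k + 1) (by positivity) (fun t x y hxy => ?_) ht₀
    refine (hlow t x y hxy).trans ?_
    gcongr
    refine (div_le_self hk0 (by linarith [abs_nonneg t])).trans (by linarith)
  choose r hr using hall
  have hrn : ∀ t, ‖r t‖ ≤ k / (1 + |t|) := fun t =>
    (hr t).norm_le (by positivity) (hlow t)
  have hrc : Continuous r := continuous_imaginary_resolvent hr (M := k) fun t =>
    (hrn t).trans (div_le_self hk0 (by linarith [abs_nonneg t]))
  have hc1 : Continuous fun t => (ContinuousLinearMap.inl ℂ H H).comp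
      ((a t).comp (ContinuousLinearMap.fst ℂ H H)) :=
    continuous_const.clm_comp (ha.continuous.clm_comp continuous_const)
  have hc2 : Continuous fun t => (ContinuousLinearMap.inr ℂ H H).comp
      ((s t).comp (ContinuousLinearMap.snd ℂ H H)) :=
    continuous_const.clm_comp (hs.continuous.clm_comp continuous_const)
  have hR₀c : Continuous R₀ := hc1.add hc2
  -- From `r - R₀ = -r P` the two decays multiply to the exponent `p - 2 < -1`. Only the diagonal
  -- part then needs the principal value.
  have hdiff : ∀ t, ‖r t - R₀ t‖ ≤ k * c * (1 + ‖t‖) ^ (-(2 - p)) := by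
    intro t
    have e : r t - R₀ t = -(r t * P t) := by
      refine ContinuousLinearMap.ext fun x => ?_
      have := (hr t).apply_of_mem_graph (hgr t x)
      rw [add_sub_cancel_right, map_add] at this
      rw [sub_apply, ← this, neg_apply, mul_apply_eq_comp]
      abel
    have ht : 0 < 1 + |t| := by positivity
    have hpow : (1 + |t|) ^ (-(2 - p)) = (1 + |t|) ^ (p - 1) / (1 + |t|) := by
      rw [← Real.rpow_sub_one ht.ne']
      congr 1
      ring
    rw [e, ContinuousLinearMap.opNorm_neg, Real.norm_eq_abs]
    calc ‖r t * P t‖ ≤ (k / (1 + |t|)) * (c * (1 + |t|) ^ (p - 1)) :=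
          (norm_mul_le _ _).trans (mul_le_mul (hrn t) (hPn t) (norm_nonneg _) (by positivity))
      _ = k * c * (1 + |t|) ^ (-(2 - p)) := by
          rw [hpow]
          ring
  have hint : Integrable fun t : ℝ => k * c * (1 + ‖t‖) ^ (-(2 - p)) :=
    (integrable_one_add_norm (by simp; linarith)).const_mul _
  have hint' : Integrable fun t => r t - R₀ t :=
    hint.mono' (hrc.sub hR₀c).aestronglyMeasurable (ae_of_all _ hdiff)
  refine ⟨r, k, ‖ContinuousLinearMap.inl ℂ H H‖ * (K * ‖ContinuousLinearMap.fst ℂ H H‖) +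
    ‖ContinuousLinearMap.inr ℂ H H‖ * (K * ‖ContinuousLinearMap.snd ℂ H H‖) +
    ∫ t, ‖r t - R₀ t‖, hr, hrn, fun N hN => ?_⟩
  have e : ∫ t in (-N)..N, r t = (∫ t in (-N)..N, R₀ t) + ∫ t in (-N)..N, (r t - R₀ t) := by
    rw [intervalIntegral.integral_sub (hrc.intervalIntegrable _ _)
      (hR₀c.intervalIntegrable _ _), add_sub_cancel]
  rw [e]
  refine (norm_add_le _ _).trans (add_le_add ?_ ?_)
  · rw [hR₀, intervalIntegral.integral_add (hc1.intervalIntegrable _ _)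
      (hc2.intervalIntegrable _ _)]
    refine (norm_add_le _ _).trans (add_le_add
      ((norm_intervalIntegral_comp_comp_le _ _ ha.continuous _ _).trans ?_)
      ((norm_intervalIntegral_comp_comp_le _ _ hs.continuous _ _).trans ?_))
    · gcongr
      exact ha.norm_integral_le N hN
    · gcongr
      exact hs.norm_integral_le N hN
  · rw [intervalIntegral.integral_of_le (by linarith)]
    exact (norm_integral_le_integral_norm _).trans
      (setIntegral_le_integral hint'.norm (ae_of_all _ fun _ => norm_nonneg _))

end HamiltonianResolvent

/-! ### Indefinite forms on the spectral subspaces and the Riccati equation. -/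

section Riccati

open MeasureTheory Set Filter Topology

variable {H : Type*} [NormedAddCommGroup H] [InnerProductSpace ℂ H]

/-- The functional `y ↦ (y₂ | x₁) - (y₁ | x₂)` of the indefinite (symplectic) form on `H × H`. -/
noncomputable def sympl (x : H × H) : (H × H) →L[ℂ] ℂ :=
  (innerSL ℂ x.1).comp (ContinuousLinearMap.snd ℂ H H) -
    (innerSL ℂ x.2).comp (ContinuousLinearMap.fst ℂ H H)

theorem sympl_apply (x y : H × H) : sympl x y = inner ℂ x.1 y.2 - inner ℂ x.2 y.1 := rfl

theorem conj_sympl (x y : H × H) : starRingEnd ℂ (sympl x y) = -sympl y x := by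
  simp only [sympl_apply, map_sub, inner_conj_symm]
  ring

theorem sympl_add_left (x y z : H × H) : sympl (x + y) z = sympl x z + sympl y z := by
  simp only [sympl_apply, Prod.fst_add, Prod.snd_add, inner_add_left]
  ring

theorem sympl_smul_left (c : ℂ) (x z : H × H) :
    sympl (c • x) z = starRingEnd ℂ c * sympl x z := by
  simp only [sympl_apply, Prod.smul_fst, Prod.smul_snd, inner_smul_left]
  ring

theorem eq_zero_of_forall_sympl {x : H × H} (h : ∀ w, sympl w x = 0) : x = 0 := by
  have h1 := h (x.2, 0)
  have h2 := h (0, x.1)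
  simp only [sympl_apply, inner_zero_left, sub_zero, zero_sub, neg_eq_zero,
    inner_self_eq_zero] at h1 h2
  exact Prod.ext h2 h1

/-- The functional `y ↦ (y₁ | x₂) + (y₂ | x₁)` of the indefinite form on `H × H` for which the
Hamiltonian is accretive. -/
noncomputable def energy (x : H × H) : (H × H) →L[ℂ] ℂ :=
  (innerSL ℂ x.2).comp (ContinuousLinearMap.fst ℂ H H) +
    (innerSL ℂ x.1).comp (ContinuousLinearMap.snd ℂ H H)

theorem energy_apply (x y : H × H) : energy x y = inner ℂ x.2 y.1 + inner ℂ x.1 y.2 := rfl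

/-- By Cauchy-Schwarz for the form, `bv` is orthogonal to the dense domain of `B`. -/
theorem eq_zero_of_re_inner_eq_zero {B : H →ₗ.[ℂ] H} (hB : IsSymmetricOp B)
    (hB0 : IsNonnegativeOp B) {v bv : H} (hv : (v, bv) ∈ B.graph)
    (h : (inner ℂ v bv).re = 0) : bv = 0 := by
  refine hB.1.eq_zero_of_inner_left ℂ fun w hw => ?_
  have h1 := sq_norm_inner_le_of_nonneg hB hB0 hv (B.mem_graph ⟨w, hw⟩)
  rw [h, zero_mul] at h1
  exact norm_eq_zero.1 (pow_eq_zero_iff two_ne_zero |>.1 (le_antisymm h1 (sq_nonneg _)))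

theorem re_nonneg_of_mem_graph {B : H →ₗ.[ℂ] H} (hB0 : IsNonnegativeOp B) {v bv : H}
    (hv : (v, bv) ∈ B.graph) : 0 ≤ (inner ℂ v bv).re := by
  obtain ⟨x, rfl, rfl⟩ := (LinearPMap.mem_graph_iff B).1 hv
  exact hB0 x

variable [CompleteSpace H] {A B C : H →ₗ.[ℂ] H}

/-- This is the Hamiltonian structure: `T` is skew for the symplectic form because the diagonal
entries are `A` and `-A*`, and the other two are symmetric. -/
theorem sympl_add_sympl_of_mem_graph (hT : IsNonnegativeHamiltonian A B C) {a a' b b' : H × H}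
    (ha : (a, a') ∈ (hamiltonian A B C).graph) (hb : (b, b') ∈ (hamiltonian A B C).graph) :
    sympl a' b + sympl a b' = 0 := by
  obtain ⟨u, v⟩ := a
  obtain ⟨u', v'⟩ := b
  obtain ⟨f, g⟩ := a'
  obtain ⟨f', g'⟩ := b'
  obtain ⟨au, bv, cu, dv, hA, hB, hC, hD, rfl, rfl⟩ := mem_graph_hamiltonian.1 ha
  obtain ⟨au', bv', cu', dv', hA', hB', hC', hD', rfl, rfl⟩ := mem_graph_hamiltonian.1 hb
  have h1 := (mem_graph_adjoint_iff hT.dense_A).1 hD' _ _ hA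
  have h2 := (mem_graph_adjoint_iff hT.dense_A).1 hD _ _ hA'
  have h2' : inner ℂ v au' = inner ℂ dv u' := by
    rw [← inner_conj_symm v au', h2, inner_conj_symm]
  have hsymm : ∀ {S : H →ₗ.[ℂ] H}, IsSymmetricOp S → ∀ {x y z w : H}, (x, y) ∈ S.graph →
      (z, w) ∈ S.graph → inner ℂ y z = inner ℂ x w := by
    intro S hS x y z w hx hz
    obtain ⟨x, rfl, rfl⟩ := (LinearPMap.mem_graph_iff S).1 hx
    obtain ⟨z, rfl, rfl⟩ := (LinearPMap.mem_graph_iff S).1 hz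
    exact hS.2 x z
  simp only [sympl_apply, inner_add_left, inner_sub_left, inner_add_right, inner_sub_right]
  rw [h1, h2', hsymm hT.symm_B hB hB', hsymm hT.symm_C hC hC']
  ring

variable {r : ℝ → (H × H) →L[ℂ] (H × H)} {M K : ℝ} {U : (H × H) →L[ℂ] (H × H)}

/-- As `it` is purely imaginary, `T - it` is again skew for the symplectic form, and so is its
inverse. -/
theorem sympl_resolvent (hT : IsNonnegativeHamiltonian A B C)
    (h : HasImaginaryResolvent (hamiltonian A B C) r M K) (t : ℝ) (x y : H × H) :
    sympl y (r t x) = starRingEnd ℂ (sympl x (r t y)) := by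
  have h1 := sympl_add_sympl_of_mem_graph hT ((h.isResolventAt t).mem_graph x)
    ((h.isResolventAt t).mem_graph y)
  rw [sympl_add_left, sympl_smul_left, map_add, map_smul, smul_eq_mul] at h1
  have h2 : starRingEnd ℂ ((t : ℂ) * Complex.I) = -((t : ℂ) * Complex.I) := by simp
  rw [h2] at h1
  have h3 : sympl x (r t y) = -sympl (r t x) y := by linear_combination h1
  rw [h3, map_neg, conj_sympl, neg_neg]

theorem tendsto_integral_apply_sign {F : Type*} [NormedAddCommGroup F] [NormedSpace ℝ F]
    [CompleteSpace F] (h : HasImaginaryResolvent (hamiltonian A B C) r M K) (hU : IsSignOf U r)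
    (L : (H × H) →L[ℝ] F) (x : H × H) :
    Tendsto (fun N : ℝ => Real.pi⁻¹ • ∫ t in (-N)..N, L (r t x)) atTop (𝓝 (L (U x))) := by
  refine ((L.continuous.tendsto _).comp (hU x)).congr fun N => ?_
  have hc : Continuous fun t => r t x := h.continuous.clm_apply continuous_const
  rw [L.intervalIntegral_comp_comm (hc.intervalIntegrable _ _), Function.comp_apply, smul_apply,
    h.integral_apply, map_smul]

theorem sympl_sign (hT : IsNonnegativeHamiltonian A B C)
    (h : HasImaginaryResolvent (hamiltonian A B C) r M K) (hU : IsSignOf U r) (x y : H × H) :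
    sympl y (U x) = starRingEnd ℂ (sympl x (U y)) := by
  have h1 := tendsto_integral_apply_sign h hU ((sympl y).restrictScalars ℝ) x
  have h2 := tendsto_integral_apply_sign h hU
    ((Complex.conjCLE : ℂ →L[ℝ] ℂ).comp ((sympl x).restrictScalars ℝ)) y
  refine tendsto_nhds_unique h1 (h2.congr fun N => ?_)
  congr 1
  refine intervalIntegral.integral_congr fun t _ => ?_
  exact (sympl_resolvent hT h t x y).symm

/-- The energy of a resolvent element is the sum of the forms of `B` and `C`. -/
theorem exists_energy_resolvent_eq (hT : IsNonnegativeHamiltonian A B C)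
    (h : HasImaginaryResolvent (hamiltonian A B C) r M K) (t : ℝ) (x : H × H) :
    ∃ au bv cu dv, ((r t x).1, au) ∈ A.graph ∧ ((r t x).2, bv) ∈ B.graph ∧
      ((r t x).1, cu) ∈ C.graph ∧ ((r t x).2, dv) ∈ A†.graph ∧
      au + bv = x.1 + ((t : ℂ) * Complex.I) • (r t x).1 ∧
      cu - dv = x.2 + ((t : ℂ) * Complex.I) • (r t x).2 ∧
      (energy x (r t x)).re = (inner ℂ (r t x).2 bv).re + (inner ℂ (r t x).1 cu).re := by
  obtain ⟨au, bv, cu, dv, hA, hB, hC, hD, h1, h2⟩ :=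
    mem_graph_hamiltonian.1 ((h.isResolventAt t).mem_graph x)
  have h1' : au + bv = x.1 + ((t : ℂ) * Complex.I) • (r t x).1 := h1.symm
  have h2' : cu - dv = x.2 + ((t : ℂ) * Complex.I) • (r t x).2 := h2.symm
  refine ⟨au, bv, cu, dv, hA, hB, hC, hD, h1', h2', ?_⟩
  have hen := energy_eq hT.dense_A t (u := (r t x).1) (v := (r t x).2) (bv := bv) (cu := cu) hA hD
  rw [← hen, h1', h2', add_sub_cancel_right, add_sub_cancel_right,
    energy_apply, Complex.add_re, add_comm]
  congr 1
  · rw [← inner_conj_symm, Complex.conj_re]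
  · rw [← inner_conj_symm, Complex.conj_re]

theorem energy_resolvent_nonneg (hT : IsNonnegativeHamiltonian A B C)
    (h : HasImaginaryResolvent (hamiltonian A B C) r M K) (t : ℝ) (x : H × H) :
    0 ≤ (energy x (r t x)).re := by
  obtain ⟨au, bv, cu, dv, -, hB, hC, -, -, -, he⟩ := exists_energy_resolvent_eq hT h t x
  rw [he]
  exact add_nonneg (re_nonneg_of_mem_graph hT.nonneg_B hB) (re_nonneg_of_mem_graph hT.nonneg_C hC)

theorem tendsto_integral_energy (h : HasImaginaryResolvent (hamiltonian A B C) r M K)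
    (hU : IsSignOf U r) (x : H × H) :
    Tendsto (fun N : ℝ => Real.pi⁻¹ • ∫ t in (-N)..N, (energy x (r t x)).re) atTop
      (𝓝 (energy x (U x)).re) :=
  tendsto_integral_apply_sign h hU (Complex.reCLM.comp ((energy x).restrictScalars ℝ)) x

theorem energy_sign_nonneg (hT : IsNonnegativeHamiltonian A B C)
    (h : HasImaginaryResolvent (hamiltonian A B C) r M K) (hU : IsSignOf U r) (x : H × H) :
    0 ≤ (energy x (U x)).re := by
  refine ge_of_tendsto (tendsto_integral_energy h hU x) ?_
  filter_upwards [eventually_ge_atTop 0] with N hN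
  refine smul_nonneg (by positivity) (intervalIntegral.integral_nonneg (by linarith) fun t _ => ?_)
  exact energy_resolvent_nonneg hT h t x

/-- The integrand is continuous and nonnegative, so the symmetric integrals increase with `N`; if
their limit is zero, the integrand vanishes at every `t`. -/
theorem energy_resolvent_eq_zero (hT : IsNonnegativeHamiltonian A B C)
    (h : HasImaginaryResolvent (hamiltonian A B C) r M K) (hU : IsSignOf U r) {x : H × H}
    (hx : (energy x (U x)).re = 0) (t : ℝ) : (energy x (r t x)).re = 0 := by
  have hc : Continuous fun t => (energy x (r t x)).re :=
    Complex.continuous_re.comp ((energy x).continuous.comp (h.continuous.clm_apply continuous_const))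
  by_contra hne
  have hpos := lt_of_le_of_ne (energy_resolvent_nonneg hT h t x) (Ne.symm hne)
  set N := |t| + 1 with hN
  have h1 : 0 < ∫ t in (-N)..N, (energy x (r t x)).re := by
    refine intervalIntegral.integral_pos (by linarith [abs_nonneg t]) hc.continuousOn
      (fun s _ => energy_resolvent_nonneg hT h s x) ⟨t, ?_, hpos⟩
    exact ⟨by linarith [neg_abs_le t], by linarith [le_abs_self t]⟩
  have h2 : Real.pi⁻¹ • ∫ t in (-N)..N, (energy x (r t x)).re ≤ 0 := by
    rw [← hx]
    refine ge_of_tendsto (tendsto_integral_energy h hU x) ?_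
    filter_upwards [eventually_ge_atTop N] with N' hN'
    refine smul_le_smul_of_nonneg_left ?_ (by positivity)
    exact intervalIntegral.integral_mono_interval (by linarith) (by linarith [abs_nonneg t]) hN'
      (ae_of_all _ fun s => energy_resolvent_nonneg hT h s x) (hc.intervalIntegrable _ _)
  have h3 : 0 < Real.pi⁻¹ • ∫ t in (-N)..N, (energy x (r t x)).re :=
    smul_pos (by positivity) h1
  exact absurd h2 (not_le.2 h3)

variable {a : ℝ → H →L[ℂ] H} {Ma Ka : ℝ}

/-- The spectral subspaces contain no vector `(0, w)` with `w ≠ 0`. -/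
theorem eq_zero_of_mem_signSpace (hT : IsNonnegativeHamiltonian A B C)
    (h : HasImaginaryResolvent (hamiltonian A B C) r M K) (hU : IsSignOf U r)
    (ha : HasImaginaryResolvent A a Ma Ka) (hker : (⋂ t : ℝ, kerBResolvent A B t) = {0}) {σ : ℝ}
    {w : H} (hw : ((0 : H), w) ∈ signSpace U σ) : w = 0 := by
  -- `U` acts as the scalar `σ`, and the energy form of `(0, w)` with itself is zero.
  have hU0 : (energy ((0 : H), w) (U ((0 : H), w))).re = 0 := by
    rw [mem_signSpace.1 hw, map_smul, energy_apply]
    simp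
  have hmem : w ∈ ⋂ t : ℝ, kerBResolvent A B t := by
    refine mem_iInter.2 fun t => ?_
    obtain ⟨au, bv, cu, dv, hA, hB, hC, hD, h1, h2, h3⟩ :=
      exists_energy_resolvent_eq hT h t ((0 : H), w)
    rw [energy_resolvent_eq_zero hT h hU hU0 t] at h3
    have hβ := re_nonneg_of_mem_graph hT.nonneg_B hB
    have hγ := re_nonneg_of_mem_graph hT.nonneg_C hC
    have hbv := eq_zero_of_re_inner_eq_zero hT.symm_B hT.nonneg_B hB (by linarith)
    have hcu := eq_zero_of_re_inner_eq_zero hT.symm_C hT.nonneg_C hC (by linarith)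
    subst hbv hcu
    have hz : -((t : ℂ) * Complex.I) ∈ opResolventSet (A†) :=
      ⟨ContinuousLinearMap.adjoint (a t), by
        simpa using (ha.isResolventAt t).adjoint hT.dense_A⟩
    have hres' := isResolventAt_opResolvent hz
    have h4 := hres'.apply_of_mem_graph hD
    -- With `Bv = 0` and `Cu = 0`, the second row reduces to `(A* + it) v = -w`, so `v` is minus the
    -- resolvent of `A*` at `-it` applied to `w`, and `B` annihilates it.
    have h5 : dv - (-((t : ℂ) * Complex.I)) • (r t ((0 : H), w)).2 = -w := by
      rw [zero_sub, neg_eq_iff_eq_neg] at h2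
      rw [h2, neg_smul]
      dsimp only
      abel
    rw [h5, map_neg, neg_eq_iff_eq_neg] at h4
    have h6 := B.graph.neg_mem hB
    simp only [Prod.neg_mk, neg_zero] at h6
    rw [← h4] at h6
    obtain ⟨⟨b, hb⟩, rfl, hb'⟩ := (LinearPMap.mem_graph_iff B).1 h6
    exact ⟨hb, hb'⟩
  rw [hker] at hmem
  exact hmem

/-- The spectral subspaces are hypermaximal neutral for the symplectic form. -/
theorem mem_signSpace_iff_sympl (hT : IsNonnegativeHamiltonian A B C)
    (h : HasImaginaryResolvent (hamiltonian A B C) r M K) (hU : IsSignOf U r) {σ : ℝ}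
    (hσ : σ = 1 ∨ σ = -1) {x : H × H} :
    x ∈ signSpace U σ ↔ ∀ y ∈ signSpace U σ, sympl y x = 0 := by
  have hσ2 : (σ : ℂ) * σ = 1 := by rcases hσ with rfl | rfl <;> simp
  have hσ0 : (σ : ℂ) ≠ 0 := left_ne_zero_of_mul_eq_one hσ2
  have hUU : ∀ x, U (U x) = x := fun x => by
    rw [← mul_apply_eq_comp, h.sign_mul_self hU, one_apply_eq_self]
  constructor
  · intro hx y hy
    -- Skewness of `U` against the common eigenvalue `σ` forces the form to equal its own negative.
    have h1 := sympl_sign hT h hU x y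
    rw [mem_signSpace.1 hx, mem_signSpace.1 hy, map_smul, map_smul, smul_eq_mul, smul_eq_mul,
      map_mul, conj_sympl, Complex.conj_ofReal] at h1
    have h2 : (σ : ℂ) * (2 * sympl y x) = 0 := by linear_combination h1
    simpa [hσ0] using h2
  · intro hx
    have h1 : x - (σ : ℂ) • U x = 0 := by
      refine eq_zero_of_forall_sympl fun w => ?_
      -- These vectors lie in the eigenspace for every `w`; skewness moves `U` to the other side, so
      -- `x - σ U x` is symplectically orthogonal to everything.
      have hw : w + (σ : ℂ) • U w ∈ signSpace U σ := by
        rw [mem_signSpace, map_add, map_smul, hUU, smul_add, smul_smul, hσ2, one_smul, add_comm]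
      have h2 := hx _ hw
      have h3 := sympl_sign hT h hU x w
      have h4 := conj_sympl x (U w)
      rw [sympl_add_left, sympl_smul_left, Complex.conj_ofReal] at h2
      rw [map_sub, map_smul, smul_eq_mul]
      linear_combination h2 - (σ : ℂ) * h3 - (σ : ℂ) * h4
    rw [mem_signSpace]
    have h2 := sub_eq_zero.1 h1
    nth_rewrite 2 [h2]
    rw [smul_smul, hσ2, one_smul]

/-- The operator whose graph is a spectral subspace of the Hamiltonian. -/
noncomputable def riccatiOperator (U : (H × H) →L[ℂ] (H × H)) (σ : ℝ) : H →ₗ.[ℂ] H :=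
  (signSpace U σ).toLinearPMap

theorem graph_riccatiOperator (hT : IsNonnegativeHamiltonian A B C)
    (h : HasImaginaryResolvent (hamiltonian A B C) r M K) (hU : IsSignOf U r)
    (ha : HasImaginaryResolvent A a Ma Ka) (hker : (⋂ t : ℝ, kerBResolvent A B t) = {0}) (σ : ℝ) :
    (riccatiOperator U σ).graph = signSpace U σ := by
  refine Submodule.toLinearPMap_graph_eq _ ?_
  rintro ⟨u, w⟩ hx hu
  have hu' : u = 0 := hu
  subst hu'
  exact eq_zero_of_mem_signSpace hT h hU ha hker hx

/-- The graph of the adjoint is the symplectic complement of the graph, which is the graph again.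
Density follows the same way: if `w` is orthogonal to the domain, then `(0, w)` lies in the
complement, hence in the graph, and `w = 0`. -/
theorem isSelfAdjoint_riccatiOperator (hT : IsNonnegativeHamiltonian A B C)
    (h : HasImaginaryResolvent (hamiltonian A B C) r M K) (hU : IsSignOf U r)
    (ha : HasImaginaryResolvent A a Ma Ka) (hker : (⋂ t : ℝ, kerBResolvent A B t) = {0}) {σ : ℝ}
    (hσ : σ = 1 ∨ σ = -1) : IsSelfAdjoint (riccatiOperator U σ) := by
  have hg := graph_riccatiOperator hT h hU ha hker σ
  have hdense : Dense ((riccatiOperator U σ).domain : Set H) := by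
    rw [Submodule.dense_iff_topologicalClosure_eq_top, Submodule.topologicalClosure_eq_top_iff,
      Submodule.eq_bot_iff]
    intro w hw
    refine eq_zero_of_mem_signSpace hT h hU ha hker
      ((mem_signSpace_iff_sympl hT h hU hσ).2 fun y hy => ?_)
    rw [← hg] at hy
    have h1 := (Submodule.mem_orthogonal _ _).1 hw y.1 (LinearPMap.mem_domain_of_mem_graph hy)
    simp [sympl_apply, h1]
  rw [LinearPMap.isSelfAdjoint_def]
  refine LinearPMap.eq_of_eq_graph ?_
  rw [LinearPMap.adjoint_graph_eq_graph_adjoint hdense, hg]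
  ext x
  rw [Submodule.mem_adjoint_iff, mem_signSpace_iff_sympl hT h hU hσ]
  constructor
  · intro hx y hy
    have h1 := hx y.1 y.2 hy
    rw [sympl_apply, ← neg_sub, h1, neg_zero]
  · intro hx u v huv
    have h1 := hx _ huv
    rw [sympl_apply] at h1
    rw [← neg_sub, h1, neg_zero]

/-- On the graph `U` is the scalar `σ`, so the nonnegative energy of `(x, Xx)` under `U` is `2σ Re
(x | Xx)`. -/
theorem nonneg_mul_inner_riccatiOperator (hT : IsNonnegativeHamiltonian A B C)
    (h : HasImaginaryResolvent (hamiltonian A B C) r M K) (hU : IsSignOf U r)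
    (ha : HasImaginaryResolvent A a Ma Ka) (hker : (⋂ t : ℝ, kerBResolvent A B t) = {0}) (σ : ℝ)
    (x : (riccatiOperator U σ).domain) :
    0 ≤ σ * (inner ℂ (x : H) (riccatiOperator U σ x)).re := by
  have hx := (riccatiOperator U σ).mem_graph x
  rw [graph_riccatiOperator hT h hU ha hker] at hx
  have h1 := energy_sign_nonneg hT h hU ((x : H), riccatiOperator U σ x)
  rw [mem_signSpace.1 hx, map_smul, energy_apply, smul_eq_mul, Complex.re_ofReal_mul,
    Complex.add_re] at h1
  have h2 : (inner ℂ (riccatiOperator U σ x) (x : H)).re =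
      (inner ℂ (x : H) (riccatiOperator U σ x)).re := by
    rw [← inner_conj_symm, Complex.conj_re]
  dsimp only at h1
  rw [h2] at h1
  linarith

theorem dense_domain_adjoint_of_resolvent (hT : IsNonnegativeHamiltonian A B C)
    (ha : HasImaginaryResolvent A a Ma Ka) : Dense (A†.domain : Set H) := by
  rw [Submodule.dense_iff_topologicalClosure_eq_top, Submodule.topologicalClosure_eq_top_iff,
    Submodule.eq_bot_iff]
  intro w hw
  have hres := (ha.isResolventAt 0).adjoint hT.dense_A
  refine (injective_iff_map_eq_zero (a 0)).1 (ha.isResolventAt 0).injective w ?_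
  refine ext_inner_left ℂ fun y => ?_
  rw [inner_zero_right, ← ContinuousLinearMap.adjoint_inner_left]
  exact (Submodule.mem_orthogonal _ _).1 hw _ (hres.mem_domain y)

theorem dense_domain_hamiltonian (hT : IsNonnegativeHamiltonian A B C)
    (ha : HasImaginaryResolvent A a Ma Ka) (hAC : A.domain ≤ C.domain)
    (hDB : A†.domain ≤ B.domain) : Dense ((hamiltonian A B C).domain : Set (H × H)) := by
  refine (hT.dense_A.prod (dense_domain_adjoint_of_resolvent hT ha)).mono ?_
  rintro ⟨u, v⟩ ⟨hu, hv⟩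
  exact ⟨⟨hu, hAC hu⟩, ⟨hDB hv, hv⟩⟩

/-- The bounded projection `(1 + σU) / 2` maps the dense domain of `T` into itself and onto a dense
part of the graph; the points obtained have first component in `D(A) ∩ X⁻¹ D(A*)`. -/
theorem hasCore_riccatiOperator (hT : IsNonnegativeHamiltonian A B C)
    (h : HasImaginaryResolvent (hamiltonian A B C) r M K) (hU : IsSignOf U r)
    (ha : HasImaginaryResolvent A a Ma Ka) (hker : (⋂ t : ℝ, kerBResolvent A B t) = {0})
    (hd : Dense ((hamiltonian A B C).domain : Set (H × H))) {σ : ℝ} (hσ : σ = 1 ∨ σ = -1) :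
    (riccatiOperator U σ).HasCore (riccatiDomain A (riccatiOperator U σ)) := by
  set X := riccatiOperator U σ with hX
  have hg : X.graph = signSpace U σ := graph_riccatiOperator hT h hU ha hker σ
  have hσ2 : (σ : ℂ) * σ = 1 := by rcases hσ with rfl | rfl <;> simp
  have hUU : ∀ x, U (U x) = x := fun x => by
    rw [← mul_apply_eq_comp, h.sign_mul_self hU, one_apply_eq_self]
  have hclosed : IsClosed (X.graph : Set (H × H)) := by
    rw [hg]
    exact isClosed_signSpace U σ
  have hXc : X.IsClosable := LinearPMap.IsClosed.isClosable hclosed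
  have hrc : (X.domRestrict (riccatiDomain A X)).IsClosable :=
    hXc.leIsClosable LinearPMap.domRestrict_le
  refine ⟨fun u hu => ((mem_riccatiDomain A X u).1 hu).2.1, LinearPMap.eq_of_eq_graph ?_⟩
  rw [← hrc.graph_closure_eq_closure_graph]
  refine le_antisymm ?_ ?_
  · exact Submodule.topologicalClosure_minimal _
      (LinearPMap.le_graph_of_le LinearPMap.domRestrict_le) hclosed
  · intro x hx
    set P : H × H → H × H := fun x => (2 : ℂ)⁻¹ • (x + (σ : ℂ) • U x) with hP
    have hPc : Continuous P := by fun_prop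
    have hPx : P x = x := by
      rw [hg, mem_signSpace] at hx
      rw [hP]
      dsimp only
      rw [hx, smul_smul, hσ2, one_smul, ← two_smul ℂ x, smul_smul]
      simp
    have hPV : ∀ y, P y ∈ X.graph := by
      intro y
      rw [hg, mem_signSpace, hP]
      dsimp only
      rw [map_smul, map_add, map_smul, hUU, smul_comm (σ : ℂ), smul_add (σ : ℂ), smul_smul, hσ2,
        one_smul, add_comm]
    have hPD : ∀ y ∈ (hamiltonian A B C).domain, P y ∈ (hamiltonian A B C).domain := by
      intro y hy
      have h1 := h.sign_mem_graph hU ((hamiltonian A B C).mem_graph ⟨y, hy⟩)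
      exact Submodule.smul_mem _ _ (Submodule.add_mem _ hy
        (Submodule.smul_mem _ _ (LinearPMap.mem_domain_of_mem_graph h1)))
    have h1 : P x ∈ closure (P '' (hamiltonian A B C).domain) :=
      image_closure_subset_closure_image hPc ⟨x, hd x, rfl⟩
    rw [hPx] at h1
    refine closure_mono ?_ h1
    rintro _ ⟨y, hy, rfl⟩
    have h2 := hPD y hy
    obtain ⟨⟨u, hu⟩, h3, h4⟩ := (LinearPMap.mem_graph_iff X).1 (hPV y)
    have hmem : u ∈ riccatiDomain A X := by
      rw [mem_riccatiDomain]
      refine ⟨?_, hu, ?_⟩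
      · have : u = (P y).1 := h3
        rw [this]
        exact h2.1.1
      · rw [h4]
        exact h2.2.2
    exact (LinearPMap.mem_graph_iff _).2 ⟨⟨u, hmem, hu⟩, h3, h4⟩

/-- By invariance `T (u, Xu)` lies on the graph, so its second component is `X` applied to its
first; this gives both membership in the domain and the equation. -/
theorem solvesRiccati_riccatiOperator (hT : IsNonnegativeHamiltonian A B C)
    (h : HasImaginaryResolvent (hamiltonian A B C) r M K) (hU : IsSignOf U r)
    (ha : HasImaginaryResolvent A a Ma Ka) (hker : (⋂ t : ℝ, kerBResolvent A B t) = {0})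
    (hAC : A.domain ≤ C.domain) (hDB : A†.domain ≤ B.domain) (σ : ℝ) :
    SolvesRiccati A B C (riccatiOperator U σ) := by
  have hg := graph_riccatiOperator hT h hU ha hker σ
  intro u hu
  obtain ⟨hA, hX, hD⟩ := (mem_riccatiDomain _ _ _).1 hu
  have h1 := (riccatiOperator U σ).mem_graph ⟨u, hX⟩
  rw [hg] at h1
  have h2 : ((u, riccatiOperator U σ ⟨u, hX⟩), _) ∈ (hamiltonian A B C).graph :=
    mem_graph_hamiltonian.2 ⟨_, _, _, _, A.mem_graph ⟨u, hA⟩, B.mem_graph ⟨_, hDB hD⟩,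
      C.mem_graph ⟨u, hAC hA⟩, A†.mem_graph ⟨_, hD⟩, rfl, rfl⟩
  have h3 := h.mem_signSpace_of_mem_graph hU h2 h1
  rw [← hg] at h3
  obtain ⟨⟨v, hv⟩, rfl, h5⟩ := (LinearPMap.mem_graph_iff _).1 h3
  refine ⟨hA, hAC hA, hX, hD, hDB hD, hv, ?_⟩
  rw [h5]
  dsimp only
  abel

end Riccati

end Dichotomy

/-! ### The main theorem. -/

open Dichotomy in
theorem mainTheorem1 {H : Type*} [NormedAddCommGroup H] [InnerProductSpace ℂ H] [CompleteSpace H]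
    (A B C : H →ₗ.[ℂ] H) (p : ℝ) (hp0 : 0 ≤ p) (hp1 : p < 1)
    (hT : IsNonnegativeHamiltonian A B C)
    (hdom : IsDiagonallyDominant p A B C)
    (hA : IsSectoriallyDichotomous A)
    (hker : (⋂ t : ℝ, kerBResolvent A B t) = {0}) :
    ∃ Xp Xm : H →ₗ.[ℂ] H,
      (IsDichotomousWith (hamiltonian A B C) Xp.graph Xm.graph ∧
        HasResolventIntegralProjections (hamiltonian A B C) Xp.graph Xm.graph) ∧
      (IsSelfAdjoint Xp ∧ IsSelfAdjoint Xm ∧ IsNonnegativeOp Xp ∧ IsNonpositiveOp Xm) ∧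
      (Xp.HasCore (riccatiDomain A Xp) ∧ Xm.HasCore (riccatiDomain A Xm)) ∧
      (SolvesRiccati A B C Xp ∧ SolvesRiccati A B C Xm) := by
  obtain ⟨a, Ma, Ka, ha⟩ := hA.exists_hasImaginaryResolvent
  have hs := ha.neg_adjoint hT.dense_A
  obtain ⟨hC, hB⟩ := hdom
  obtain ⟨c₁, hc₁, QC, hQC, hQC'⟩ := hC.exists_comp_resolvent ha hp0 hp1
  obtain ⟨c₂, hc₂, QB, hQB, hQB'⟩ := hB.exists_comp_resolvent hs hp0 hp1
  obtain ⟨r, M, K, h⟩ := hasImaginaryResolvent_hamiltonian (c := c₁ + c₂) hT ha (by positivity) hp1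
    hQB (fun t => (hQB' t).trans (by gcongr; linarith)) hQC
    (fun t => (hQC' t).trans (by gcongr; linarith))
  have hAC : A.domain ≤ C.domain := hC.1
  have hDB : A†.domain ≤ B.domain := hB.1
  have hd := dense_domain_hamiltonian hT ha hAC hDB
  obtain ⟨U, hU⟩ := h.exists_sign hd
  have hg := graph_riccatiOperator hT h hU ha hker
  refine ⟨riccatiOperator U 1, riccatiOperator U (-1), ⟨?_, ?_⟩,
    ⟨isSelfAdjoint_riccatiOperator hT h hU ha hker (Or.inl rfl),
      isSelfAdjoint_riccatiOperator hT h hU ha hker (Or.inr rfl), fun x => ?_, fun x => ?_⟩,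
    ⟨hasCore_riccatiOperator hT h hU ha hker hd (Or.inl rfl),
      hasCore_riccatiOperator hT h hU ha hker hd (Or.inr rfl)⟩,
    ⟨solvesRiccati_riccatiOperator hT h hU ha hker hAC hDB 1,
      solvesRiccati_riccatiOperator hT h hU ha hker hAC hDB (-1)⟩⟩
  · rw [hg, hg]
    exact h.isDichotomousWith hU hd
  · rw [hg, hg]
    exact h.hasResolventIntegralProjections hU
  · simpa using nonneg_mul_inner_riccatiOperator hT h hU ha hker 1 x
  · simpa using nonneg_mul_inner_riccatiOperator hT h hU ha hker (-1) x
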